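/- All power series are formal power series in $q$; for such a series $a_n$ denotes the coefficient of $q^n$, and $a_n\sim b_n$ means $a_n/b_n\to 1$ as $n\to\infty$. Infinite products are limits with respect to coefficientwise convergence, and the products below converge in this sense. (1) Let $m\ge 1$ be an integer and $\displaystyle\prod_{k=1}^{\infty}\frac{1}{(1+q^k)^m}=\sum_{n\ge 0}a_nq^n$. Then $$a_n\sim(-1)^n\,\frac{m^{1/4}}{2^{7/4}\,3^{1/4}\,n^{3/4}}\exp\left(\pi\sqrt{\frac{mn}{6}}\right).$$ (2) Let $m\ge 2$ be an integer and $\displaystyle\prod_{k=1}^{\infty}\frac{1+q^{mk}}{1+q^k}=\sum_{n\ge 0}a_nq^n$. If $m$ is even, then $$a_n\sim(-1)^n\,\frac{(m+2)^{1/4}}{4\,(6m)^{1/4}\,n^{3/4}}\exp\left(\pi\sqrt{\frac{(m+2)n}{6m}}\right);$$ if $m$ is odd, then $$a_n\sim(-1)^n\,\frac{(m-1)^{1/4}}{2^{3/2}\,(6m)^{1/4}\,n^{3/4}}\exp\left(\pi\sqrt{\frac{(m-1)n}{6m}}\right).$$ -/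

import Mathlib

open Filter Asymptotics
open scoped PowerSeries PowerSeries.WithPiTopology

/-- The `k`-th factor `1 / (1 + q ^ k) ^ m`, as a formal power series in `q`. For `k ≥ 1` the
denominator has constant coefficient `1`, so this is its multiplicative inverse. -/
noncomputable def invPowFactor (m k : ℕ) : ℝ⟦X⟧ :=
  ((1 + (PowerSeries.X : ℝ⟦X⟧) ^ k) ^ m)⁻¹

/-- The `k`-th factor `(1 + q ^ (m * k)) / (1 + q ^ k)`, as a formal power series in `q`. -/
noncomputable def ratioFactor (m k : ℕ) : ℝ⟦X⟧ :=
  (1 + (PowerSeries.X : ℝ⟦X⟧) ^ (m * k)) * (1 + (PowerSeries.X : ℝ⟦X⟧) ^ k)⁻¹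

/-- The formal power series `∏_{k ≥ 1} 1 / (1 + q ^ k) ^ m`: an infinite product in the topology
of coefficientwise convergence. -/
noncomputable def invPowProduct (m : ℕ) : ℝ⟦X⟧ :=
  ∏' k : ℕ, invPowFactor m (k + 1)

/-- The formal power series `∏_{k ≥ 1} (1 + q ^ (m * k)) / (1 + q ^ k)`: an infinite product in
the topology of coefficientwise convergence. -/
noncomputable def ratioProduct (m : ℕ) : ℝ⟦X⟧ :=
  ∏' k : ℕ, ratioFactor m (k + 1)

/-!
# Coefficients of `∏ 1 / (1 + q ^ k) ^ m` and `∏ (1 + q ^ (m k)) / (1 + q ^ k)`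

By Euler's identity `∏ (1 + q ^ k) * ∏ (1 - q ^ (2 k - 1)) = 1`, replacing `q` by `-q` turns both
products into products `∏ (1 + q ^ j) ^ c j` with exponents `c j ≥ 0`: the exponent is `m` on the
odd numbers for the first product; for the second one it is the sum of the indicators of the odd
numbers and of the multiples of `m` if `m` is even, and the indicator of the odd numbers not
divisible by `m` if `m` is odd. This accounts for the sign `(-1) ^ n`, and leaves a product with
nonnegative coefficients whose dominant singularity is at `q = 1`
(`invPowProduct_eq`, `ratioProduct_eq_of_even`, `ratioProduct_eq_of_odd`).

All of these are products and quotients of values of `∏ (1 + q ^ k)` at powers of `q`. As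
`∏ (1 + q ^ k)` is, up to a power of `q`, the quotient `η(2τ) / η(τ)`, the transformation of `η`
under `τ ↦ -1 / τ` gives `∏ (1 + q ^ k) ∼ 2^{-1/2} e^{π² / (12 z)}` for `q = e^{-z}`, `z → 0`
(`tendsto_eulerProd_multipleInd_one`), hence a behaviour `C e^{A / z}` for each product
(`HasExpGrowth`).

The circle method turns this into the asymptotics of the coefficients
(`coeff_eulerProd_isEquivalent`). Cauchy's formula is used on the circle `|q| = e^{-t}` with
`t = √(A / n)`, the saddle point of `A / z + n z`. At `z = t + i t^{3/2} v` the integrand, divided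
by `e^{2 √(A n)}`, tends to `C e^{-A v²}`. Dominated convergence applies because each factor
satisfies `|1 + ρ e^{iα}| ≤ (1 + ρ) e^{-ρ (1 - cos α) / 4}`, and the sum of `ρ (1 - cos α)` over the
factors with `j ≡ 1 mod M` is bounded below on the whole circle (`dampingSum_ge`): near `θ = 0` it
is at least of order `θ² / t³`, and away from `0` it exceeds a multiple of `t^{-1/4}`, since `jθ`
cannot be close to `2πℤ` for all `j ≡ 1 mod M` unless `θ` itself is.
-/

/-! ### Lower bounds for the damping sum -/

theorem half_le_natFloor {x : ℝ} (hx : 1 ≤ x) : x / 2 ≤ (⌊x⌋₊ : ℝ) := by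
  have h1 := Nat.lt_floor_add_one x
  have h2 : (1 : ℝ) ≤ (⌊x⌋₊ : ℝ) := by exact_mod_cast (Nat.one_le_floor_iff x).2 hx
  linarith

theorem cube_div_three_le_sum_sq (K : ℕ) :
    (K : ℝ) ^ 3 / 3 ≤ ∑ k ∈ Finset.range K, ((k : ℝ) + 1) ^ 2 := by
  induction K with
  | zero => simp
  | succ K ih =>
    rw [Finset.sum_range_succ]
    push_cast
    have : (0 : ℝ) ≤ K := K.cast_nonneg
    nlinarith

theorem abs_sin_nat_mul_le (k : ℕ) (x : ℝ) : |Real.sin (k * x)| ≤ k * |Real.sin x| := by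
  induction k with
  | zero => simp
  | succ k ih =>
    push_cast
    rw [add_mul, one_mul, Real.sin_add]
    have h1 := abs_add_le (Real.sin (k * x) * Real.cos x) (Real.cos (k * x) * Real.sin x)
    rw [abs_mul, abs_mul] at h1
    have h2 := mul_le_of_le_one_right (abs_nonneg (Real.sin (k * x))) (Real.abs_cos_le_one x)
    have h3 := mul_le_of_le_one_left (abs_nonneg (Real.sin x)) (Real.abs_cos_le_one (k * x))
    linarith

theorem abs_sin_le_abs_sin_add (a b : ℝ) : |Real.sin a| ≤ |Real.sin (a + b)| + |Real.sin b| := by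
  have h : Real.sin a = Real.sin (a + b) * Real.cos b - Real.cos (a + b) * Real.sin b := by
    rw [← Real.sin_sub]; ring_nf
  rw [h]
  have h1 := abs_sub (Real.sin (a + b) * Real.cos b) (Real.cos (a + b) * Real.sin b)
  rw [abs_mul, abs_mul] at h1
  have h2 := mul_le_of_le_one_right (abs_nonneg (Real.sin (a + b))) (Real.abs_cos_le_one b)
  have h3 := mul_le_of_le_one_left (abs_nonneg (Real.sin b)) (Real.abs_cos_le_one (a + b))
  linarith

/-- The damping sum `∑ e^{-jt} (1 - cos jθ)` over the first `K` terms of the progression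
`j ≡ 1 mod M`. It measures how much smaller the product `∏ (1 + q ^ j)` is at
`q = e^{-t - iθ}` than at `q = e^{-t}`. -/
noncomputable def dampingSum (M : ℕ) (t θ : ℝ) (K : ℕ) : ℝ :=
  ∑ k ∈ Finset.range K,
    Real.exp (-(((1 + M * k : ℕ) : ℝ) * t)) * (1 - Real.cos (((1 + M * k : ℕ) : ℝ) * θ))

/-- The weights `e^{-jt}` are at least `e^{-1}` as long as `j t ≤ 1`. -/
theorem sum_le_dampingSum {M : ℕ} (hM : 1 ≤ M) {t : ℝ} (ht : 0 ≤ t) (θ : ℝ) {K : ℕ}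
    (hK : M * K * t ≤ 1) {f : ℕ → ℝ}
    (hf : ∀ k < K, f k ≤ 1 - Real.cos (((1 + M * k : ℕ) : ℝ) * θ)) :
    Real.exp (-1) * ∑ k ∈ Finset.range K, f k ≤ dampingSum M t θ K := by
  rw [dampingSum, Finset.mul_sum]
  refine Finset.sum_le_sum fun k hk => ?_
  rw [Finset.mem_range] at hk
  have h0 : 0 ≤ 1 - Real.cos (((1 + M * k : ℕ) : ℝ) * θ) := by
    linarith [Real.cos_le_one (((1 + M * k : ℕ) : ℝ) * θ)]
  have h1 : 1 + M * k ≤ M * K := by nlinarith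
  have h2 : ((1 + M * k : ℕ) : ℝ) * t ≤ 1 :=
    (mul_le_mul_of_nonneg_right (by exact_mod_cast h1) ht).trans hK
  calc Real.exp (-1) * f k
      ≤ Real.exp (-1) * (1 - Real.cos (((1 + M * k : ℕ) : ℝ) * θ)) := by
        gcongr; exact hf k hk
    _ ≤ _ := by gcongr

/-- For small `θ`, the terms with `j ≤ 1 / max t |θ|` are comparable to `j² θ²`. -/
theorem dampingSum_ge_of_abs_le {M : ℕ} (hM : 2 ≤ M) {s θ : ℝ} (hs : 0 < s) (hs0 : s ≤ 1 / (2 * M))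
    (hθ : |θ| ≤ s) :
    ∃ K, Real.exp (-1) / (400 * M ^ 3) * min (θ ^ 2 / s ^ 12) (1 / s) ≤
      dampingSum M (s ^ 4) θ K := by
  have hM' : (2 : ℝ) ≤ M := by exact_mod_cast hM
  set τ := max (s ^ 4) |θ| with hτ
  have hτ0 : 0 < τ := lt_max_of_lt_left (by positivity)
  have hs1 : s ≤ 1 := hs0.trans (by rw [div_le_one (by positivity)]; linarith)
  have hτs : τ ≤ s := max_le (pow_le_of_le_one hs.le hs1 (by norm_num)) hθ
  have hMτ : M * τ ≤ 1 := by
    have : M * τ ≤ M * (1 / (2 * M)) := by gcongr; exact hτs.trans hs0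
    refine this.trans ?_
    field_simp
    norm_num
  have hx : 1 ≤ 1 / (M * τ) := by rw [le_div_iff₀ (by positivity)]; linarith
  set K := ⌊1 / (M * τ)⌋₊ with hK
  have hK1 : 1 / (M * τ) / 2 ≤ K := half_le_natFloor hx
  have hK2 : (K : ℝ) ≤ 1 / (M * τ) := Nat.floor_le (by positivity)
  have hK3 : M * K * τ ≤ 1 := by
    rw [le_div_iff₀ (by positivity)] at hK2; linarith
  refine ⟨K, ?_⟩
  have hpi : Real.pi ^ 2 < 10 := by nlinarith [Real.pi_lt_d2, Real.pi_pos]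
  have key := sum_le_dampingSum (M := M) (by omega) (t := s ^ 4) (by positivity) θ (K := K)
    ((mul_le_mul_of_nonneg_left (le_max_left _ _) (by positivity)).trans hK3)
    (f := fun k => 1 / 5 * θ ^ 2 * ((k : ℝ) + 1) ^ 2) (by
      intro k hk
      have h1 : 1 + M * k ≤ M * K := by nlinarith
      have h2 : ((1 + M * k : ℕ) : ℝ) * |θ| ≤ 1 :=
        (mul_le_mul (by exact_mod_cast h1 : ((1 + M * k : ℕ) : ℝ) ≤ M * K) (le_max_right _ _)
          (abs_nonneg _) (by positivity)).trans hK3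
      have h3 : |((1 + M * k : ℕ) : ℝ) * θ| ≤ Real.pi := by
        rw [abs_mul, abs_of_nonneg (by positivity)]
        linarith [Real.pi_gt_three]
      have h4 := Real.cos_le_one_sub_mul_cos_sq h3
      have h5 : (k : ℝ) + 1 ≤ ((1 + M * k : ℕ) : ℝ) := by
        push_cast; nlinarith [(Nat.cast_nonneg k : (0 : ℝ) ≤ k)]
      have h6 : 1 / 5 ≤ 2 / Real.pi ^ 2 := by
        rw [div_le_div_iff₀ (by norm_num) (by positivity)]; linarith
      calc 1 / 5 * θ ^ 2 * ((k : ℝ) + 1) ^ 2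
          ≤ 2 / Real.pi ^ 2 * θ ^ 2 * ((1 + M * k : ℕ) : ℝ) ^ 2 := by gcongr
        _ = 2 / Real.pi ^ 2 * (((1 + M * k : ℕ) : ℝ) * θ) ^ 2 := by ring
        _ ≤ _ := by linarith)
  refine le_trans ?_ key
  rw [← Finset.mul_sum]
  have hsum := cube_div_three_le_sum_sq K
  have hcube : (1 / (M * τ) / 2) ^ 3 ≤ (K : ℝ) ^ 3 := by gcongr
  have hmin : min (θ ^ 2 / s ^ 12) (1 / s) ≤ θ ^ 2 / τ ^ 3 := by
    rcases le_total (s ^ 4) |θ| with h | h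
    · refine (min_le_right _ _).trans ?_
      have hθ0 : 0 < |θ| := lt_of_lt_of_le (by positivity) h
      rw [hτ, max_eq_right h, ← sq_abs, show |θ| ^ 2 / |θ| ^ 3 = 1 / |θ| by field_simp]
      gcongr
    · refine (min_le_left _ _).trans (le_of_eq ?_)
      rw [hτ, max_eq_left h]; ring
  calc Real.exp (-1) / (400 * M ^ 3) * min (θ ^ 2 / s ^ 12) (1 / s)
      ≤ Real.exp (-1) / (400 * M ^ 3) * (θ ^ 2 / τ ^ 3) := by gcongr
    _ = Real.exp (-1) * (8 / 400 * θ ^ 2 * (1 / (M * τ) / 2) ^ 3) := by field_simp; ring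
    _ ≤ Real.exp (-1) * (8 / 400 * θ ^ 2 * K ^ 3) := by gcongr
    _ ≤ Real.exp (-1) * (1 / 5 * θ ^ 2 * (K ^ 3 / 3)) := by
        gcongr ?_ * ?_
        have : 0 ≤ θ ^ 2 * (K : ℝ) ^ 3 := by positivity
        linarith
    _ ≤ _ := by gcongr

/-- If `Mθ` is not close to `2πℤ`, then of two consecutive multiples `jθ`, `(j + M)θ` at least one
is not close to `2πℤ` either. -/
theorem dampingSum_ge_of_sin_ge {M : ℕ} (hM : 2 ≤ M) {s θ : ℝ} (hs : 0 < s)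
    (hs0 : s ≤ 1 / (2 * M)) (hθ : s / 2 ≤ |Real.sin (M * θ / 2)|) :
    ∃ K, Real.exp (-1) / (400 * M ^ 3) * (1 / s) ≤ dampingSum M (s ^ 4) θ K := by
  have hM' : (2 : ℝ) ≤ M := by exact_mod_cast hM
  have hs1 : s ≤ 1 := hs0.trans (by rw [div_le_one (by positivity)]; linarith)
  have hMs : M * s ≤ 1 / 2 := by
    rw [le_div_iff₀ (by positivity)] at hs0; linarith
  have hs4 : s ^ 4 ≤ s := pow_le_of_le_one hs.le hs1 (by norm_num)
  have hx : 2 ≤ 1 / (M * s ^ 4) := by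
    rw [le_div_iff₀ (by positivity)]; nlinarith
  set K := ⌊1 / (M * s ^ 4)⌋₊ with hK
  have hK1 : 1 / (M * s ^ 4) / 2 ≤ K := half_le_natFloor (by linarith)
  have hK2 : (K : ℝ) ≤ 1 / (M * s ^ 4) := Nat.floor_le (by positivity)
  have hK3 : M * K * s ^ 4 ≤ 1 := by
    rw [le_div_iff₀ (by positivity)] at hK2; linarith
  have hK4 : 2 ≤ K := Nat.le_floor (by exact_mod_cast hx)
  refine ⟨K, ?_⟩
  have key := sum_le_dampingSum (M := M) (by omega) (t := s ^ 4) (by positivity) θ (K := K) hK3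
    (f := fun k => 2 * Real.sin (((1 + M * k : ℕ) : ℝ) * θ / 2) ^ 2) (by
      intro k hk
      rw [Real.sin_sq_eq_half_sub]
      apply le_of_eq
      ring_nf)
  refine le_trans ?_ key
  obtain ⟨L, hL⟩ : ∃ L, K = L + 1 := ⟨K - 1, by omega⟩
  have hpair : ∀ k, s ^ 2 / 8 ≤ Real.sin (((1 + M * k : ℕ) : ℝ) * θ / 2) ^ 2 +
      Real.sin (((1 + M * (k + 1) : ℕ) : ℝ) * θ / 2) ^ 2 := by
    intro k
    have h := abs_sin_le_abs_sin_add (M * θ / 2) (((1 + M * k : ℕ) : ℝ) * θ / 2)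
    rw [show M * θ / 2 + ((1 + M * k : ℕ) : ℝ) * θ / 2
      = ((1 + M * (k + 1) : ℕ) : ℝ) * θ / 2 by push_cast; ring] at h
    rw [← sq_abs (Real.sin (((1 + M * k : ℕ) : ℝ) * θ / 2)),
      ← sq_abs (Real.sin (((1 + M * (k + 1) : ℕ) : ℝ) * θ / 2))]
    set x := |Real.sin (((1 + M * k : ℕ) : ℝ) * θ / 2)|
    set y := |Real.sin (((1 + M * (k + 1) : ℕ) : ℝ) * θ / 2)|
    nlinarith [sq_nonneg (x - y)]
  have hsum : L * (s ^ 2 / 8) ≤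
      2 * ∑ k ∈ Finset.range K, Real.sin (((1 + M * k : ℕ) : ℝ) * θ / 2) ^ 2 := by
    have h1 : L * (s ^ 2 / 8) ≤ ∑ k ∈ Finset.range L,
        (Real.sin (((1 + M * k : ℕ) : ℝ) * θ / 2) ^ 2 +
          Real.sin (((1 + M * (k + 1) : ℕ) : ℝ) * θ / 2) ^ 2) := by
      have := Finset.card_nsmul_le_sum (Finset.range L) _ _ (fun k _ => hpair k)
      simpa using this
    rw [Finset.sum_add_distrib] at h1
    have h2 := Finset.sum_range_succ
      (fun k : ℕ => Real.sin (((1 + M * k : ℕ) : ℝ) * θ / 2) ^ 2) L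
    have h3 := Finset.sum_range_succ'
      (fun k : ℕ => Real.sin (((1 + M * k : ℕ) : ℝ) * θ / 2) ^ 2) L
    rw [hL]
    have h4 := sq_nonneg (Real.sin (((1 + M * L : ℕ) : ℝ) * θ / 2))
    have h5 := sq_nonneg (Real.sin (((1 + M * 0 : ℕ) : ℝ) * θ / 2))
    linarith
  rw [← Finset.mul_sum]
  have hL2 : (K : ℝ) / 2 ≤ L := by
    have : (2 : ℝ) ≤ K := by exact_mod_cast hK4
    have h' : (K : ℝ) = L + 1 := by exact_mod_cast hL
    linarith
  calc Real.exp (-1) / (400 * M ^ 3) * (1 / s)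
      ≤ Real.exp (-1) / (32 * M) * (1 / s ^ 2) := by
        have h1 : (32 * M : ℝ) ≤ 400 * M ^ 3 := by
          have : (M : ℝ) ≤ M ^ 3 := le_self_pow₀ (by linarith) (by norm_num)
          linarith
        have h2 : s ^ 2 ≤ s := pow_le_of_le_one hs.le hs1 (by norm_num)
        gcongr
    _ = Real.exp (-1) * (1 / (M * s ^ 4) / 2 / 2 * (s ^ 2 / 8)) := by field_simp; ring
    _ ≤ Real.exp (-1) * (L * (s ^ 2 / 8)) := by gcongr; linarith
    _ ≤ _ := by gcongr

/-- If `Mθ` is close to `2πℤ` while `θ` is not, then `(1 + M k)θ` stays away from `2πℤ` for all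
`k` up to a multiple of `1 / s`. -/
theorem dampingSum_ge_of_sin_lt {M : ℕ} (hM : 2 ≤ M) {s θ : ℝ} (hs : 0 < s)
    (hs0 : s ≤ 1 / (2 * M)) (hθs : s ≤ |θ|) (hθpi : |θ| ≤ Real.pi)
    (hθ : |Real.sin (M * θ / 2)| < s / 2) :
    ∃ K, Real.exp (-1) / (400 * M ^ 3) * (1 / s) ≤ dampingSum M (s ^ 4) θ K := by
  have hM' : (2 : ℝ) ≤ M := by exact_mod_cast hM
  have hs1 : s ≤ 1 := hs0.trans (by rw [div_le_one (by positivity)]; linarith)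
  have hMs : M * s ≤ 1 / 2 := by
    rw [le_div_iff₀ (by positivity)] at hs0; linarith
  have hx : 1 ≤ 1 / (M * s) := by
    rw [le_div_iff₀ (by positivity)]; linarith
  set K := ⌊1 / (M * s)⌋₊ with hK
  have hK1 : 1 / (M * s) / 2 ≤ K := half_le_natFloor hx
  have hK2 : (K : ℝ) ≤ 1 / (M * s) := Nat.floor_le (by positivity)
  have hK3 : M * K * s ≤ 1 := by
    rw [le_div_iff₀ (by positivity)] at hK2; linarith
  refine ⟨K, ?_⟩
  -- `θ` stays away from `0`, since otherwise `sin (M θ / 2)` would be comparable to `M θ / 2`.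
  have hθM : Real.pi < M * |θ| := by
    by_contra! hcon
    have h1 : |M * θ / 2| ≤ Real.pi / 2 := by
      rw [abs_div, abs_mul, abs_of_nonneg (by positivity : (0 : ℝ) ≤ M), abs_two]; linarith
    have h2 := Real.mul_abs_le_abs_sin h1
    rw [abs_div, abs_mul, abs_of_nonneg (by positivity : (0 : ℝ) ≤ M), abs_two] at h2
    have h3 : s / 2 ≤ 2 / Real.pi * (M * |θ| / 2) := by
      rw [div_mul_eq_mul_div, le_div_iff₀ Real.pi_pos]
      nlinarith [Real.pi_lt_four]
    linarith
  have hsin : 1 / M ≤ |Real.sin (θ / 2)| := by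
    have h1 : |θ / 2| ≤ Real.pi / 2 := by rw [abs_div, abs_two]; linarith
    refine le_trans ?_ (Real.mul_abs_le_abs_sin h1)
    rw [abs_div, abs_two, div_mul_eq_mul_div, div_le_div_iff₀ (by positivity) Real.pi_pos]
    linarith
  have key := sum_le_dampingSum (M := M) (by omega) (t := s ^ 4) (by positivity) θ (K := K)
    ((mul_le_mul_of_nonneg_left (pow_le_of_le_one hs.le hs1 (by norm_num))
      (by positivity)).trans hK3)
    (f := fun _ => 2 * (1 / (2 * M)) ^ 2) (by
      intro k hk
      have h1 := abs_sin_le_abs_sin_add (θ / 2) (k * (M * θ / 2))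
      have h2 := abs_sin_nat_mul_le k (M * θ / 2)
      have h3 : (k : ℝ) * |Real.sin (M * θ / 2)| ≤ 1 / (2 * M) := by
        have hkK : (k : ℝ) ≤ 1 / (M * s) := (by exact_mod_cast hk.le : (k : ℝ) ≤ K).trans hK2
        calc (k : ℝ) * |Real.sin (M * θ / 2)| ≤ 1 / (M * s) * (s / 2) := by gcongr
          _ = 1 / (2 * M) := by field_simp
      have h4 : 1 / (2 * M) ≤ |Real.sin (((1 + M * k : ℕ) : ℝ) * θ / 2)| := by
        rw [show ((1 + M * k : ℕ) : ℝ) * θ / 2 = θ / 2 + k * (M * θ / 2) by push_cast; ring]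
        have : (1 : ℝ) / M = 1 / (2 * M) + 1 / (2 * M) := by field_simp; norm_num
        linarith
      have h5 : (1 / (2 * M : ℝ)) ^ 2 ≤ Real.sin (((1 + M * k : ℕ) : ℝ) * θ / 2) ^ 2 := by
        rw [← sq_abs (Real.sin _)]; gcongr
      rw [Real.sin_sq_eq_half_sub,
        show 2 * (((1 + M * k : ℕ) : ℝ) * θ / 2) = ((1 + M * k : ℕ) : ℝ) * θ by ring] at h5
      linarith)
  refine le_trans ?_ key
  rw [Finset.sum_const, Finset.card_range, nsmul_eq_mul]
  calc Real.exp (-1) / (400 * M ^ 3) * (1 / s)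
      ≤ Real.exp (-1) / (4 * M ^ 3) * (1 / s) := by gcongr; norm_num
    _ = Real.exp (-1) * (1 / (M * s) / 2 * (2 * (1 / (2 * M)) ^ 2)) := by field_simp; ring
    _ ≤ _ := by gcongr

/-- The lower bound for the damping sum on the whole circle, with `t = s ^ 4`. The constant is not
optimal: it is small enough for each of the three ranges of `θ`. -/
theorem dampingSum_ge {M : ℕ} (hM : 2 ≤ M) {s θ : ℝ} (hs : 0 < s) (hs0 : s ≤ 1 / (2 * M))
    (hθ : |θ| ≤ Real.pi) :
    ∃ K, Real.exp (-1) / (400 * M ^ 3) * min (θ ^ 2 / s ^ 12) (1 / s) ≤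
      dampingSum M (s ^ 4) θ K := by
  rcases le_total |θ| s with h | h
  · exact dampingSum_ge_of_abs_le hM hs hs0 h
  · have h1 : Real.exp (-1) / (400 * M ^ 3) * min (θ ^ 2 / s ^ 12) (1 / s) ≤
        Real.exp (-1) / (400 * M ^ 3) * (1 / s) := by
      gcongr
      exact min_le_right _ _
    obtain ⟨K, hK⟩ : ∃ K, Real.exp (-1) / (400 * M ^ 3) * (1 / s) ≤ dampingSum M (s ^ 4) θ K := by
      rcases le_or_gt (s / 2) |Real.sin (M * θ / 2)| with h2 | h2
      · exact dampingSum_ge_of_sin_ge hM hs hs0 h2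
      · exact dampingSum_ge_of_sin_lt hM hs hs0 h hθ h2
    exact ⟨K, h1.trans hK⟩

/-! ### The products `∏ (1 + x ^ j) ^ c j` and Cauchy's formula -/

/-- The partial product `∏_{j < N} (1 + x ^ j) ^ c j`. -/
def eulerPartial {R : Type*} [CommSemiring R] (c : ℕ → ℕ) (N : ℕ) (x : R) : R :=
  ∏ j ∈ Finset.range N, (1 + x ^ j) ^ c j

/-- The infinite product `∏_j (1 + x ^ j) ^ c j` in a topological ring, used with `c 0 = 0`. -/
noncomputable def eulerProd {R : Type*} [CommSemiring R] [TopologicalSpace R] (c : ℕ → ℕ)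
    (x : R) : R :=
  ∏' j, (1 + x ^ j) ^ c j

/-- The products `∏_j (1 + x ^ j) ^ c j` converge for all bounded exponents `c` with `c 0 = 0`. -/
def EulerConvergent {R : Type*} [CommSemiring R] [TopologicalSpace R] (x : R) : Prop :=
  ∀ (c : ℕ → ℕ) (B : ℕ), c 0 = 0 → (∀ j, c j ≤ B) → Multipliable fun j => (1 + x ^ j) ^ c j

/-- It suffices to treat products of distinct factors `1 + x ^ j`, since a product with exponents
bounded by `B` is a product of `B` of these. -/
theorem eulerConvergent_of_indicator {R : Type*} [CommSemiring R] [TopologicalSpace R]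
    [ContinuousMul R] {x : R}
    (h : ∀ p : ℕ → Prop, [DecidablePred p] → ¬ p 0 →
      Multipliable fun j => 1 + if p j then x ^ j else 0) :
    EulerConvergent x := by
  intro c B hc0 hB
  have h1 : Multipliable fun j => ∏ i ∈ Finset.range B, (1 + if i < c j then x ^ j else 0) :=
    multipliable_prod fun i _ => h (fun j => i < c j) (by simp [hc0])
  refine h1.congr fun j => ?_
  have h2 : ∀ i ∈ Finset.range B, (1 + if i < c j then x ^ j else 0) =
      if i < c j then 1 + x ^ j else 1 := by
    intro i _
    split_ifs <;> simp
  have h3 : (Finset.range B).filter (fun i => i < c j) = Finset.range (c j) := by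
    ext i
    simp only [Finset.mem_filter, Finset.mem_range]
    have := hB j
    omega
  rw [Finset.prod_congr rfl h2, ← Finset.prod_filter, h3, Finset.prod_const, Finset.card_range]

theorem eulerConvergent_of_norm_lt_one {q : ℂ} (hq : ‖q‖ < 1) : EulerConvergent q := by
  refine eulerConvergent_of_indicator fun p _ _ => multipliable_one_add_of_summable ?_
  refine Summable.of_nonneg_of_le (fun _ => norm_nonneg _) (fun j => ?_)
    (summable_geometric_of_lt_one (norm_nonneg q) hq)
  split_ifs
  · simp
  · simp

theorem eulerConvergent_of_constantCoeff_eq_zero {x : ℝ⟦X⟧}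
    (hx : PowerSeries.constantCoeff x = 0) : EulerConvergent x := by
  refine eulerConvergent_of_indicator fun p _ _ =>
    PowerSeries.WithPiTopology.multipliable_one_add_of_tendsto_order_atTop_nhds_top ℝ ?_
  refine ENat.tendsto_nhds_top_iff_natCast_lt.mpr fun n =>
    Filter.eventually_atTop.mpr ⟨n + 1, fun j hj => ?_⟩
  split_ifs
  · have h1 : 1 ≤ x.order := PowerSeries.one_le_order_iff_constCoeff_eq_zero.mpr hx
    calc (n : ℕ∞) < (j : ℕ∞) := by exact_mod_cast hj
      _ = j • (1 : ℕ∞) := by simp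
      _ ≤ j • x.order := nsmul_le_nsmul_right h1 j
      _ ≤ _ := PowerSeries.le_order_pow _ _
  · rw [PowerSeries.order_zero]
    exact ENat.natCast_lt_top n

theorem EulerConvergent.tendsto_eulerPartial {R : Type*} [CommSemiring R] [TopologicalSpace R]
    {x : R} (hx : EulerConvergent x) {c : ℕ → ℕ} {B : ℕ} (hc0 : c 0 = 0) (hB : ∀ j, c j ≤ B) :
    Tendsto (fun N => eulerPartial c N x) atTop (nhds (eulerProd c x)) :=
  (hx c B hc0 hB).tendsto_prod_tprod_nat

theorem coeff_eulerPartial_succ (c : ℕ → ℕ) {n N : ℕ} (h : n < N) :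
    PowerSeries.coeff n (eulerPartial c (N + 1) (PowerSeries.X : ℝ⟦X⟧)) =
      PowerSeries.coeff n (eulerPartial c N (PowerSeries.X : ℝ⟦X⟧)) := by
  rw [eulerPartial, Finset.prod_range_succ, ← eulerPartial]
  obtain ⟨y, hy⟩ : ∃ y : ℝ⟦X⟧, (1 + PowerSeries.X ^ N) ^ c N = 1 + PowerSeries.X ^ N * y := by
    have h1 := sub_dvd_pow_sub_pow (1 + (PowerSeries.X : ℝ⟦X⟧) ^ N) 1 (c N)
    rw [add_sub_cancel_left, one_pow] at h1
    obtain ⟨y, hy⟩ := h1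
    exact ⟨y, by rw [← hy]; ring⟩
  rw [hy, mul_add, mul_one, map_add, mul_left_comm, PowerSeries.coeff_X_pow_mul',
    if_neg (by omega), add_zero]

theorem coeff_eulerProd (c : ℕ → ℕ) {B : ℕ} (hc0 : c 0 = 0) (hB : ∀ j, c j ≤ B) {n N : ℕ}
    (h : n < N) :
    PowerSeries.coeff n (eulerProd c (PowerSeries.X : ℝ⟦X⟧)) =
      (eulerPartial c N (Polynomial.X : Polynomial ℝ)).coeff n := by
  have h1 : ((eulerPartial c N (Polynomial.X : Polynomial ℝ) : Polynomial ℝ) : ℝ⟦X⟧) =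
      eulerPartial c N (PowerSeries.X : ℝ⟦X⟧) := by
    change Polynomial.coeToPowerSeries.ringHom (eulerPartial c N Polynomial.X) = _
    simp [eulerPartial, map_prod]
  rw [← Polynomial.coeff_coe, h1]
  have h2 := ((PowerSeries.WithPiTopology.continuous_coeff ℝ n).tendsto _).comp
    ((eulerConvergent_of_constantCoeff_eq_zero PowerSeries.constantCoeff_X).tendsto_eulerPartial
      hc0 hB)
  refine tendsto_nhds_unique h2 (tendsto_const_nhds.congr' ?_)
  filter_upwards [eventually_ge_atTop N] with K hK
  induction K, hK using Nat.le_induction with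
  | base => rfl
  | succ K hK ih => rw [ih]; exact (coeff_eulerPartial_succ c (by omega)).symm

theorem integral_exp_int_mul (k : ℤ) :
    ∫ θ in (-Real.pi)..Real.pi, Complex.exp (k * (θ * Complex.I)) =
      if k = 0 then ((2 * Real.pi : ℝ) : ℂ) else 0 := by
  split_ifs with hk
  · subst hk
    simp
    ring
  · have hc : (k : ℂ) * Complex.I ≠ 0 := mul_ne_zero (by exact_mod_cast hk) Complex.I_ne_zero
    have h := integral_exp_mul_complex (a := -Real.pi) (b := Real.pi) hc
    have h1 : ∀ θ : ℝ, (k : ℂ) * (θ * Complex.I) = k * Complex.I * θ := fun θ => by ring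
    simp_rw [h1]
    rw [h, div_eq_zero_iff]
    left
    rw [sub_eq_zero, Complex.exp_eq_exp_iff_exists_int]
    exact ⟨k, by push_cast; ring⟩

/-- Cauchy's coefficient formula on the circle `|q| = e^{-t}`, for polynomials. -/
theorem integral_aeval_mul_exp (p : Polynomial ℝ) (n : ℕ) (t : ℝ) :
    ∫ θ in (-Real.pi)..Real.pi,
        Polynomial.aeval (Complex.exp (-(t + θ * Complex.I))) p *
          Complex.exp (n * (t + θ * Complex.I)) =
      ((2 * Real.pi * p.coeff n : ℝ) : ℂ) := by
  have h1 : ∀ θ : ℝ, Polynomial.aeval (Complex.exp (-(t + θ * Complex.I))) p *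
      Complex.exp (n * (t + θ * Complex.I)) = ∑ k ∈ Finset.range (p.natDegree + 1),
        (p.coeff k * Complex.exp (((n : ℤ) - k : ℤ) * t)) *
          Complex.exp (((n : ℤ) - k : ℤ) * (θ * Complex.I)) := by
    intro θ
    rw [Polynomial.aeval_eq_sum_range, Finset.sum_mul]
    refine Finset.sum_congr rfl fun k _ => ?_
    rw [Complex.real_smul, ← Complex.exp_nat_mul, mul_assoc, mul_assoc, ← Complex.exp_add,
      ← Complex.exp_add]
    congr 2
    push_cast
    ring
  simp_rw [h1]
  rw [intervalIntegral.integral_finsetSum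
    (fun k _ => (Continuous.intervalIntegrable (by fun_prop) _ _))]
  simp_rw [intervalIntegral.integral_const_mul, integral_exp_int_mul]
  have h2 : ∀ k : ℕ, ((n : ℤ) - k = 0) ↔ n = k := fun k => by omega
  simp_rw [h2, mul_ite, mul_zero]
  rw [Finset.sum_ite_eq]
  split_ifs with h
  · simp
    ring
  · rw [Finset.mem_range, not_lt] at h
    rw [Polynomial.coeff_eq_zero_of_natDegree_lt (by omega)]
    simp

theorem aeval_eulerPartial (c : ℕ → ℕ) (N : ℕ) (q : ℂ) :
    Polynomial.aeval q (eulerPartial c N (Polynomial.X : Polynomial ℝ)) = eulerPartial c N q := by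
  simp [eulerPartial, map_prod]

theorem norm_one_add_le {ρ : ℝ} (h0 : 0 ≤ ρ) (h1 : ρ ≤ 1) (α : ℝ) :
    ‖1 + (ρ : ℂ) * Complex.exp (α * Complex.I)‖ ≤
      (1 + ρ) * Real.exp (-(ρ * (1 - Real.cos α) / 4)) := by
  refine (sq_le_sq₀ (norm_nonneg _) (by positivity)).1 ?_
  have h2 : ‖1 + (ρ : ℂ) * Complex.exp (α * Complex.I)‖ ^ 2 =
      (1 + ρ) ^ 2 - 2 * ρ * (1 - Real.cos α) := by
    rw [Complex.sq_norm, Complex.normSq_apply, Complex.exp_mul_I, ← Complex.ofReal_cos,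
      ← Complex.ofReal_sin]
    simp only [Complex.add_re, Complex.add_im, Complex.mul_re, Complex.mul_im, Complex.one_re,
      Complex.one_im, Complex.ofReal_re, Complex.ofReal_im, Complex.I_re, Complex.I_im]
    linear_combination ρ ^ 2 * Real.sin_sq_add_cos_sq α
  have h3 := Real.add_one_le_exp (-(ρ * (1 - Real.cos α) / 2))
  have h5 : (1 + ρ) ^ 2 ≤ 4 := by nlinarith
  have h4 : 0 ≤ ρ * (1 - Real.cos α) := mul_nonneg h0 (by linarith [Real.cos_le_one α])
  rw [h2, mul_pow, ← Real.exp_nat_mul,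
    show ((2 : ℕ) : ℝ) * -(ρ * (1 - Real.cos α) / 4) = -(ρ * (1 - Real.cos α) / 2) by
      push_cast; ring]
  calc (1 + ρ) ^ 2 - 2 * ρ * (1 - Real.cos α)
      ≤ (1 + ρ) ^ 2 * (-(ρ * (1 - Real.cos α) / 2) + 1) := by
        nlinarith [mul_le_mul_of_nonneg_right h5 h4]
    _ ≤ _ := by gcongr

/-- Only the factors with `j ≡ 1 mod M` are used to bound the quotient of the values at
`e^{-t - iθ}` and `e^{-t}`; the other factors contribute at most `1` to it. -/
theorem norm_eulerPartial_le {c : ℕ → ℕ} {M : ℕ} (hM : 1 ≤ M) (hcM : ∀ k, 1 ≤ c (1 + M * k))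
    {t : ℝ} (ht : 0 ≤ t) (θ : ℝ) {K N : ℕ} (hN : 1 + M * K ≤ N) :
    ‖eulerPartial c N (Complex.exp (-(t + θ * Complex.I)))‖ ≤
      eulerPartial c N (Real.exp (-t)) * Real.exp (-(dampingSum M t θ K / 4)) := by
  set d : ℕ → ℝ := fun j => Real.exp (-(j * t)) * (1 - Real.cos (j * θ)) with hd
  have hd0 : ∀ j, 0 ≤ d j := fun j =>
    mul_nonneg (Real.exp_pos _).le (by linarith [Real.cos_le_one (j * θ)])
  have hfac : ∀ j : ℕ, ‖(1 + Complex.exp (-(t + θ * Complex.I)) ^ j) ^ c j‖ ≤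
      (1 + Real.exp (-t) ^ j) ^ c j * Real.exp (-(c j * d j / 4)) := by
    intro j
    have h1 : Complex.exp (-(t + θ * Complex.I)) ^ j =
        ((Real.exp (-(j * t)) : ℝ) : ℂ) * Complex.exp ((-(j * θ) : ℝ) * Complex.I) := by
      rw [← Complex.exp_nat_mul, Complex.ofReal_exp, ← Complex.exp_add]
      congr 1
      push_cast
      ring
    have h2 := norm_one_add_le (Real.exp_pos (-(j * t))).le
      (Real.exp_le_one_iff.mpr (by simpa using by positivity)) (-(j * θ))
    rw [← h1, Real.cos_neg] at h2
    rw [norm_pow]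
    refine (pow_le_pow_left₀ (norm_nonneg _) h2 (c j)).trans (le_of_eq ?_)
    rw [mul_pow, ← Real.exp_nat_mul, ← Real.exp_nat_mul]
    congr 2
    · ring_nf
    · rw [hd]; ring
  have hsum : dampingSum M t θ K ≤ ∑ j ∈ Finset.range N, c j * d j := by
    have h1 : dampingSum M t θ K = ∑ j ∈ (Finset.range K).image (fun k => 1 + M * k), d j := by
      rw [Finset.sum_image (fun a _ b _ hab => by
        have : M * a = M * b := by simpa using hab
        exact Nat.eq_of_mul_eq_mul_left (by omega) this)]
      rfl
    rw [h1]
    calc ∑ j ∈ (Finset.range K).image (fun k => 1 + M * k), d j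
        ≤ ∑ j ∈ (Finset.range K).image (fun k => 1 + M * k), c j * d j := by
          refine Finset.sum_le_sum fun j hj => ?_
          obtain ⟨k, _, rfl⟩ := Finset.mem_image.mp hj
          exact le_mul_of_one_le_left (hd0 _) (by exact_mod_cast hcM k)
      _ ≤ _ := by
          refine Finset.sum_le_sum_of_subset_of_nonneg (fun j hj => ?_)
            fun j _ _ => mul_nonneg (Nat.cast_nonneg _) (hd0 j)
          obtain ⟨k, hk, rfl⟩ := Finset.mem_image.mp hj
          rw [Finset.mem_range] at hk ⊢
          have : M * k < M * K := (Nat.mul_lt_mul_left (by omega)).2 hk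
          omega
  have hpos : 0 ≤ eulerPartial c N (Real.exp (-t)) :=
    Finset.prod_nonneg fun j _ => by positivity
  calc ‖eulerPartial c N (Complex.exp (-(t + θ * Complex.I)))‖
      ≤ ∏ j ∈ Finset.range N, (1 + Real.exp (-t) ^ j) ^ c j * Real.exp (-(c j * d j / 4)) := by
        rw [eulerPartial, norm_prod]
        exact Finset.prod_le_prod (fun _ _ => norm_nonneg _) fun j _ => hfac j
    _ = eulerPartial c N (Real.exp (-t)) *
          Real.exp (-((∑ j ∈ Finset.range N, c j * d j) / 4)) := by
        rw [Finset.prod_mul_distrib, ← Real.exp_sum, Finset.sum_neg_distrib, Finset.sum_div]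
        rfl
    _ ≤ _ := by gcongr

theorem norm_exp_neg_lt_one {z : ℂ} (hz : 0 < z.re) : ‖Complex.exp (-z)‖ < 1 := by
  rw [Complex.norm_exp]
  simpa using hz

theorem eulerPartial_le_norm_eulerProd {c : ℕ → ℕ} {B : ℕ} (hc0 : c 0 = 0) (hB : ∀ j, c j ≤ B)
    {t : ℝ} (ht : 0 < t) (N : ℕ) :
    eulerPartial c N (Real.exp (-t)) ≤ ‖eulerProd c (Complex.exp (-t))‖ := by
  have hq := eulerConvergent_of_norm_lt_one (norm_exp_neg_lt_one (z := t) (by simpa using ht))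
  have hcast : ∀ N, eulerPartial c N (Complex.exp (-t)) =
      ((eulerPartial c N (Real.exp (-t)) : ℝ) : ℂ) := fun N => by simp [eulerPartial]
  have hone : ∀ j, 1 ≤ (1 + Real.exp (-t) ^ j) ^ c j := fun j =>
    one_le_pow₀ (by have := Real.exp_pos (-t); linarith [pow_pos this j])
  have hnn : ∀ N, 0 ≤ eulerPartial c N (Real.exp (-t)) := fun N =>
    Finset.prod_nonneg fun j _ => by positivity
  have hlim := (hq.tendsto_eulerPartial hc0 hB).norm
  refine Monotone.ge_of_tendsto (f := fun N => eulerPartial c N (Real.exp (-t)))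
    (monotone_nat_of_le_succ fun N => ?_) (hlim.congr fun N => ?_) N
  · rw [eulerPartial, eulerPartial, Finset.prod_range_succ]
    exact le_mul_of_one_le_right (hnn N) (hone N)
  · rw [hcast, Complex.norm_real, Real.norm_of_nonneg (hnn N)]

theorem norm_eulerProd_le {c : ℕ → ℕ} {B : ℕ} (hc0 : c 0 = 0) (hB : ∀ j, c j ≤ B)
    {M : ℕ} (hM : 1 ≤ M) (hcM : ∀ k, 1 ≤ c (1 + M * k)) {t : ℝ} (ht : 0 < t) (θ : ℝ) (K : ℕ) :
    ‖eulerProd c (Complex.exp (-(t + θ * Complex.I)))‖ ≤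
      ‖eulerProd c (Complex.exp (-t))‖ * Real.exp (-(dampingSum M t θ K / 4)) := by
  have hq := eulerConvergent_of_norm_lt_one
    (norm_exp_neg_lt_one (z := t + θ * Complex.I) (by simpa using ht))
  refine le_of_tendsto (hq.tendsto_eulerPartial hc0 hB).norm ?_
  filter_upwards [eventually_ge_atTop (1 + M * K)] with N hN
  refine (norm_eulerPartial_le hM hcM ht.le θ hN).trans ?_
  gcongr
  exact eulerPartial_le_norm_eulerProd hc0 hB ht N

/-- Cauchy's coefficient formula for the infinite product. -/
theorem integral_eulerProd_mul_exp {c : ℕ → ℕ} {B : ℕ} (hc0 : c 0 = 0) (hB : ∀ j, c j ≤ B)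
    (n : ℕ) {t : ℝ} (ht : 0 < t) :
    ∫ θ in (-Real.pi)..Real.pi,
        eulerProd c (Complex.exp (-(t + θ * Complex.I))) * Complex.exp (n * (t + θ * Complex.I)) =
      ((2 * Real.pi * PowerSeries.coeff n (eulerProd c (PowerSeries.X : ℝ⟦X⟧)) : ℝ) : ℂ) := by
  have hlim : Tendsto (fun N => ∫ θ in (-Real.pi)..Real.pi,
        eulerPartial c N (Complex.exp (-(t + θ * Complex.I))) *
          Complex.exp (n * (t + θ * Complex.I))) atTop
      (nhds (∫ θ in (-Real.pi)..Real.pi,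
        eulerProd c (Complex.exp (-(t + θ * Complex.I))) *
          Complex.exp (n * (t + θ * Complex.I)))) := by
    refine intervalIntegral.tendsto_integral_filter_of_dominated_convergence
      (fun _ => ‖eulerProd c (Complex.exp (-t))‖ * Real.exp (n * t)) ?_ ?_ ?_ ?_
    · refine Eventually.of_forall fun N => Continuous.aestronglyMeasurable ?_
      unfold eulerPartial
      fun_prop
    · refine Eventually.of_forall fun N => Eventually.of_forall fun θ _ => ?_
      rw [norm_mul, Complex.norm_exp]
      refine mul_le_mul ?_ (by simp) (Real.exp_pos _).le (norm_nonneg _)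
      refine le_trans ?_ (eulerPartial_le_norm_eulerProd hc0 hB ht N)
      rw [eulerPartial, eulerPartial, norm_prod]
      refine Finset.prod_le_prod (fun _ _ => norm_nonneg _) fun j _ => ?_
      rw [norm_pow]
      gcongr
      refine (norm_add_le _ _).trans ?_
      rw [norm_one, norm_pow, Complex.norm_exp]
      simp
    · exact intervalIntegrable_const
    · refine Eventually.of_forall fun θ _ => ?_
      exact ((eulerConvergent_of_norm_lt_one
        (norm_exp_neg_lt_one (by simpa using ht))).tendsto_eulerPartial hc0 hB).mul_const _
  refine tendsto_nhds_unique hlim (tendsto_const_nhds.congr' ?_)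
  filter_upwards [eventually_gt_atTop n] with N hN
  rw [coeff_eulerProd c hc0 hB hN, ← integral_aeval_mul_exp _ n t]
  simp_rw [aeval_eulerPartial]

/-! ### The saddle point integral -/

/-- The integrand of Cauchy's formula at `z = s ^ 4 + i s ^ 6 v` with `n = A / s ^ 8`, divided by
its expected size `e^{2 A / s ^ 4}` and extended by zero beyond the full circle
`|s ^ 6 v| ≤ π`. The radius is `e^{-t}` with `t = s ^ 4`, so that all fractional powers of `t` that
occur are powers of `s`. -/
noncomputable def saddleIntegrand (c : ℕ → ℕ) (A s v : ℝ) : ℂ :=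
  (Set.Ioc (-(Real.pi / s ^ 6)) (Real.pi / s ^ 6)).indicator (fun v : ℝ =>
    eulerProd c (Complex.exp (-((s ^ 4 : ℝ) + (s ^ 6 * v : ℝ) * Complex.I))) *
      Complex.exp ((A / s ^ 8 : ℝ) * ((s ^ 4 : ℝ) + (s ^ 6 * v : ℝ) * Complex.I) -
        (2 * A / s ^ 4 : ℝ))) v

/-- The exponential damping dominates the integrand by a multiple of `1 / (1 + v²)`: on the range
`|v| ≤ π / s ^ 6` the bound `e^{-κ / s}` beats `s ^ 12`. -/
theorem exp_neg_min_le {κ : ℝ} (hκ : 0 < κ) {s v : ℝ} (hs : 0 < s) (hs1 : s ≤ 1)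
    (hv : |v| ≤ Real.pi / s ^ 6) :
    Real.exp (-(κ * min (v ^ 2) (1 / s))) ≤
      (1 + 1 / κ + 11 * (Nat.factorial 12 : ℕ) / κ ^ 12) * (1 + v ^ 2)⁻¹ := by
  have hv0 : 0 < 1 + v ^ 2 := by positivity
  rw [← div_eq_mul_inv, le_div_iff₀ hv0]
  rcases le_total (v ^ 2) (1 / s) with h | h
  · rw [min_eq_left h, Real.exp_neg, inv_mul_le_iff₀ (Real.exp_pos _)]
    have h1 := Real.add_one_le_exp (κ * v ^ 2)
    have h2 : 0 ≤ 11 * ((Nat.factorial 12 : ℕ) : ℝ) / κ ^ 12 := by positivity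
    calc 1 + v ^ 2 ≤ (κ * v ^ 2 + 1) * (1 + 1 / κ) := by
          have : (κ * v ^ 2 + 1) * (1 + 1 / κ) = 1 + v ^ 2 + κ * v ^ 2 + 1 / κ := by
            field_simp
            ring
          rw [this]
          have : 0 ≤ κ * v ^ 2 + 1 / κ := by positivity
          linarith
      _ ≤ _ := mul_le_mul h1 (by linarith) (by positivity) (Real.exp_pos _).le
  · rw [min_eq_right h, Real.exp_neg, inv_mul_le_iff₀ (Real.exp_pos _)]
    have h1 := Real.pow_div_factorial_le_exp (κ * (1 / s)) (by positivity) 12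
    have h2 : v ^ 2 ≤ 10 / s ^ 12 := by
      rw [← sq_abs]
      calc |v| ^ 2 ≤ (Real.pi / s ^ 6) ^ 2 := by gcongr
        _ = Real.pi ^ 2 / s ^ 12 := by ring
        _ ≤ _ := by
          gcongr
          nlinarith [Real.pi_lt_d2, Real.pi_pos]
    have h3 : 1 ≤ 1 / s ^ 12 := by
      rw [le_div_iff₀ (by positivity), one_mul]
      exact pow_le_one₀ hs.le hs1
    calc 1 + v ^ 2 ≤ 11 / s ^ 12 := by
          have : 11 / s ^ 12 = 1 / s ^ 12 + 10 / s ^ 12 := by ring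
          linarith
      _ = (κ * (1 / s)) ^ 12 / (Nat.factorial 12 : ℕ) *
            (11 * (Nat.factorial 12 : ℕ) / κ ^ 12) := by
          have : ((Nat.factorial 12 : ℕ) : ℝ) ≠ 0 := by positivity
          field_simp
      _ ≤ _ := by
          gcongr
          have : 0 ≤ 1 + 1 / κ := by positivity
          linarith

theorem inv_re_saddlePath {s : ℝ} (hs : 0 < s) (v : ℝ) :
    (((s ^ 4 : ℝ) + (s ^ 6 * v : ℝ) * Complex.I : ℂ)⁻¹).re =
      (s ^ 4 * (1 + s ^ 4 * v ^ 2))⁻¹ := by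
  have hd : Complex.normSq ((s ^ 4 : ℝ) + (s ^ 6 * v : ℝ) * Complex.I : ℂ) =
      s ^ 8 * (1 + s ^ 4 * v ^ 2) := by
    rw [Complex.normSq_add_mul_I]
    ring
  have hre : ((s ^ 4 : ℝ) + (s ^ 6 * v : ℝ) * Complex.I : ℂ).re = s ^ 4 := by
    simp only [Complex.add_re, Complex.mul_re, Complex.ofReal_re, Complex.ofReal_im,
      Complex.I_re, Complex.I_im]
    ring
  rw [Complex.inv_re, hd, hre]
  have : 0 < 1 + s ^ 4 * v ^ 2 := by positivity
  field_simp

/-- Along the path `z = s ^ 4 + i s ^ 6 v` with `v` fixed, `Re (1 / z) → ∞` as `s → 0`. -/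
theorem tendsto_saddlePath (v : ℝ) :
    Tendsto (fun s : ℝ => ((s ^ 4 : ℝ) + (s ^ 6 * v : ℝ) * Complex.I : ℂ))
      (nhdsWithin 0 (Set.Ioi 0))
      (comap (fun z : ℂ => (z⁻¹).re) atTop) := by
  rw [tendsto_comap_iff]
  have h1 : Tendsto (fun s : ℝ => s ^ 4 * (1 + s ^ 4 * v ^ 2)) (nhdsWithin 0 (Set.Ioi 0))
      (nhdsWithin 0 (Set.Ioi 0)) := by
    refine tendsto_nhdsWithin_iff.mpr ⟨?_, ?_⟩
    · have : Continuous fun s : ℝ => s ^ 4 * (1 + s ^ 4 * v ^ 2) := by fun_prop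
      simpa using (this.tendsto 0).mono_left nhdsWithin_le_nhds
    · filter_upwards [self_mem_nhdsWithin] with s hs
      have : (0 : ℝ) < s := hs
      exact Set.mem_Ioi.mpr (by positivity)
  refine h1.inv_tendsto_nhdsGT_zero.congr' ?_
  filter_upwards [self_mem_nhdsWithin] with s hs
  exact (inv_re_saddlePath hs v).symm

/-- With `z = t (1 + iu)`, `n = A / t²`: `n z - 2 A / t = -A / z - (A / t) u² / (1 + iu)`. -/
theorem saddle_exponent_eq (A : ℝ) {s : ℝ} (hs : 0 < s) (v : ℝ) :
    (A / s ^ 8 : ℝ) * ((s ^ 4 : ℝ) + (s ^ 6 * v : ℝ) * Complex.I : ℂ) - (2 * A / s ^ 4 : ℝ) =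
      -(A / ((s ^ 4 : ℝ) + (s ^ 6 * v : ℝ) * Complex.I : ℂ)) +
        -(A * v ^ 2 / (1 + s ^ 2 * v * Complex.I)) := by
  have hs' : (s : ℂ) ≠ 0 := by exact_mod_cast hs.ne'
  have h1 : (1 + s ^ 2 * v * Complex.I : ℂ) ≠ 0 := by
    intro h
    simpa [← Complex.ofReal_pow] using congrArg Complex.re h
  have h2 : ((s ^ 4 : ℝ) + (s ^ 6 * v : ℝ) * Complex.I : ℂ) =
      s ^ 4 * (1 + s ^ 2 * v * Complex.I) := by
    push_cast
    ring
  rw [h2]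
  push_cast
  field_simp
  ring_nf
  simp only [Complex.I_sq]
  ring

theorem tendsto_saddleIntegrand {c : ℕ → ℕ} {A C : ℝ}
    (hlim : Tendsto (fun z : ℂ => eulerProd c (Complex.exp (-z)) * Complex.exp (-(A / z)))
      (comap (fun z : ℂ => (z⁻¹).re) atTop) (nhds C)) (v : ℝ) :
    Tendsto (fun s => saddleIntegrand c A s v) (nhdsWithin 0 (Set.Ioi 0))
      (nhds ((C * Real.exp (-A * v ^ 2) : ℝ) : ℂ)) := by
  have h1 := hlim.comp (tendsto_saddlePath v)
  have h2 : Tendsto (fun s : ℝ => Complex.exp (-(A * v ^ 2 / (1 + s ^ 2 * v * Complex.I))))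
      (nhdsWithin 0 (Set.Ioi 0)) (nhds (Complex.exp (-(A * v ^ 2)))) := by
    have : ContinuousAt
        (fun s : ℝ => Complex.exp (-(A * v ^ 2 / (1 + s ^ 2 * v * Complex.I)))) 0 := by
      fun_prop (disch := simp)
    simpa using this.tendsto.mono_left nhdsWithin_le_nhds
  have h3 := h1.mul h2
  have h4 : (C : ℂ) * Complex.exp (-(A * v ^ 2)) = ((C * Real.exp (-A * v ^ 2) : ℝ) : ℂ) := by
    push_cast
    ring_nf
  rw [h4] at h3
  refine h3.congr' ?_
  have h5 : Tendsto (fun s : ℝ => Real.pi / s ^ 6) (nhdsWithin 0 (Set.Ioi 0)) atTop := by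
    have h6 : Tendsto (fun s : ℝ => s ^ 6) (nhdsWithin 0 (Set.Ioi 0))
        (nhdsWithin 0 (Set.Ioi 0)) := by
      refine tendsto_nhdsWithin_iff.mpr ⟨?_, ?_⟩
      · have : Continuous fun s : ℝ => s ^ 6 := by fun_prop
        simpa using (this.tendsto 0).mono_left nhdsWithin_le_nhds
      · filter_upwards [self_mem_nhdsWithin] with s hs
        have : (0 : ℝ) < s := hs
        exact Set.mem_Ioi.mpr (by positivity)
    exact h6.inv_tendsto_nhdsGT_zero.const_mul_atTop Real.pi_pos
  filter_upwards [self_mem_nhdsWithin, h5.eventually_gt_atTop |v|] with s hs hsv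
  have hmem : v ∈ Set.Ioc (-(Real.pi / s ^ 6)) (Real.pi / s ^ 6) :=
    ⟨(abs_lt.mp hsv).1, (abs_lt.mp hsv).2.le⟩
  rw [saddleIntegrand, Set.indicator_of_mem hmem, saddle_exponent_eq A hs, Complex.exp_add,
    ← mul_assoc]
  rfl

theorem aestronglyMeasurable_saddleIntegrand {c : ℕ → ℕ} {B : ℕ} (hc0 : c 0 = 0)
    (hB : ∀ j, c j ≤ B) (A : ℝ) {s : ℝ} (hs : 0 < s) :
    MeasureTheory.AEStronglyMeasurable (saddleIntegrand c A s) := by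
  have h1 : MeasureTheory.AEStronglyMeasurable (fun v : ℝ =>
      eulerProd c (Complex.exp (-((s ^ 4 : ℝ) + (s ^ 6 * v : ℝ) * Complex.I)))) := by
    refine aestronglyMeasurable_of_tendsto_ae atTop (f := fun N (v : ℝ) =>
      eulerPartial c N (Complex.exp (-((s ^ 4 : ℝ) + (s ^ 6 * v : ℝ) * Complex.I))))
      (fun N => Continuous.aestronglyMeasurable ?_) (Eventually.of_forall fun v => ?_)
    · unfold eulerPartial
      fun_prop
    · refine (eulerConvergent_of_norm_lt_one (norm_exp_neg_lt_one ?_)).tendsto_eulerPartial hc0 hB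
      have : 0 < s ^ 4 := by positivity
      simpa [← Complex.ofReal_pow] using this
  exact (h1.mul (Continuous.aestronglyMeasurable (by fun_prop))).indicator measurableSet_Ioc

theorem norm_saddleIntegrand_le {c : ℕ → ℕ} {B : ℕ} (hc0 : c 0 = 0) (hB : ∀ j, c j ≤ B)
    {M : ℕ} (hM : 2 ≤ M) (hcM : ∀ k, 1 ≤ c (1 + M * k)) (A : ℝ) :
    ∃ D, 0 ≤ D ∧ ∀ s v : ℝ, 0 < s → s ≤ 1 / (2 * M) →
      ‖saddleIntegrand c A s v‖ ≤
        ‖eulerProd c (Complex.exp (-(s ^ 4 : ℝ)))‖ * Real.exp (-(A / s ^ 4)) *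
          (D * (1 + v ^ 2)⁻¹) := by
  set κ := Real.exp (-1) / (400 * M ^ 3) / 4 with hκ
  have hM0 : (2 : ℝ) ≤ M := by exact_mod_cast hM
  have hκ0 : 0 < κ := by positivity
  refine ⟨1 + 1 / κ + 11 * (Nat.factorial 12 : ℕ) / κ ^ 12, by positivity, fun s v hs hsM => ?_⟩
  have hs1 : s ≤ 1 := hsM.trans (by rw [div_le_one (by positivity)]; linarith)
  by_cases hv : v ∈ Set.Ioc (-(Real.pi / s ^ 6)) (Real.pi / s ^ 6)
  swap
  · rw [saddleIntegrand, Set.indicator_of_notMem hv, norm_zero]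
    positivity
  have hv' : |v| ≤ Real.pi / s ^ 6 := abs_le.mpr ⟨hv.1.le, hv.2⟩
  rw [saddleIntegrand, Set.indicator_of_mem hv, norm_mul, Complex.norm_exp]
  have hre : ((A / s ^ 8 : ℝ) * ((s ^ 4 : ℝ) + (s ^ 6 * v : ℝ) * Complex.I : ℂ) -
      (2 * A / s ^ 4 : ℝ)).re = -(A / s ^ 4) := by
    simp only [Complex.add_re, Complex.sub_re, Complex.mul_re, Complex.ofReal_re,
      Complex.ofReal_im, Complex.I_re, Complex.I_im]
    field_simp
    ring
  rw [hre]
  have hθ : |s ^ 6 * v| ≤ Real.pi := by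
    rw [abs_mul, abs_of_pos (by positivity : 0 < s ^ 6)]
    rw [le_div_iff₀ (by positivity)] at hv'
    linarith
  obtain ⟨K, hK⟩ := dampingSum_ge hM hs hsM hθ
  have h1 := norm_eulerProd_le hc0 hB (by omega) hcM (by positivity : 0 < s ^ 4) (s ^ 6 * v) K
  have h2 : Real.exp (-(dampingSum M (s ^ 4) (s ^ 6 * v) K / 4)) ≤
      Real.exp (-(κ * min (v ^ 2) (1 / s))) := by
    have h3 : (s ^ 6 * v) ^ 2 / s ^ 12 = v ^ 2 := by field_simp
    rw [h3] at hK
    apply Real.exp_le_exp.mpr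
    rw [hκ]
    linarith
  calc _ ≤ ‖eulerProd c (Complex.exp (-(s ^ 4 : ℝ)))‖ *
        Real.exp (-(dampingSum M (s ^ 4) (s ^ 6 * v) K / 4)) * Real.exp (-(A / s ^ 4)) := by
        gcongr
    _ = ‖eulerProd c (Complex.exp (-(s ^ 4 : ℝ)))‖ * Real.exp (-(A / s ^ 4)) *
        Real.exp (-(dampingSum M (s ^ 4) (s ^ 6 * v) K / 4)) := by ring
    _ ≤ _ := by
        gcongr
        exact h2.trans (exp_neg_min_le hκ0 hs hs1 hv')

theorem tendsto_integral_saddleIntegrand {c : ℕ → ℕ} {B : ℕ} (hc0 : c 0 = 0)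
    (hB : ∀ j, c j ≤ B) {M : ℕ} (hM : 2 ≤ M) (hcM : ∀ k, 1 ≤ c (1 + M * k)) {A C : ℝ}
    (hlim : Tendsto (fun z : ℂ => eulerProd c (Complex.exp (-z)) * Complex.exp (-(A / z)))
      (comap (fun z : ℂ => (z⁻¹).re) atTop) (nhds C)) :
    Tendsto (fun s => ∫ v, saddleIntegrand c A s v) (nhdsWithin 0 (Set.Ioi 0))
      (nhds ((C * √(Real.pi / A) : ℝ) : ℂ)) := by
  obtain ⟨D, hD0, hD⟩ := norm_saddleIntegrand_le hc0 hB hM hcM A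
  have h1 : ∫ v : ℝ, ((C * Real.exp (-A * v ^ 2) : ℝ) : ℂ) = ((C * √(Real.pi / A) : ℝ) : ℂ) := by
    rw [integral_complex_ofReal, MeasureTheory.integral_const_mul, integral_gaussian]
  rw [← h1]
  have hM0 : (2 : ℝ) ≤ M := by exact_mod_cast hM
  have hpos : (0 : ℝ) < 1 / (2 * M) := by positivity
  have hbd : ∀ᶠ s : ℝ in nhdsWithin 0 (Set.Ioi 0),
      ‖eulerProd c (Complex.exp (-(s ^ 4 : ℝ)))‖ * Real.exp (-(A / s ^ 4)) ≤ ‖(C : ℂ)‖ + 1 := by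
    have h2 := (hlim.comp (tendsto_saddlePath 0)).norm.eventually_le_const
      (lt_add_one ‖(C : ℂ)‖)
    filter_upwards [h2] with s hs
    change ‖eulerProd c (Complex.exp (-((s ^ 4 : ℝ) + (s ^ 6 * 0 : ℝ) * Complex.I))) *
      Complex.exp (-(A / ((s ^ 4 : ℝ) + (s ^ 6 * 0 : ℝ) * Complex.I)))‖ ≤ _ at hs
    rwa [mul_zero, Complex.ofReal_zero, zero_mul, add_zero, norm_mul,
      Complex.norm_exp (-(A / _)), ← Complex.ofReal_div, ← Complex.ofReal_neg (A / _),
      Complex.ofReal_re] at hs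
  refine MeasureTheory.tendsto_integral_filter_of_dominated_convergence
    (fun v => (‖(C : ℂ)‖ + 1) * (D * (1 + v ^ 2)⁻¹)) ?_ ?_ ?_ ?_
  · filter_upwards [self_mem_nhdsWithin] with s hs
    exact aestronglyMeasurable_saddleIntegrand hc0 hB A hs
  · filter_upwards [hbd, self_mem_nhdsWithin,
      mem_nhdsWithin_of_mem_nhds (Iio_mem_nhds hpos)] with s hs hs0 hsM
    refine Eventually.of_forall fun v => (hD s v hs0 (le_of_lt hsM)).trans ?_
    gcongr
  · exact (integrable_inv_one_add_sq.const_mul _).const_mul _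
  · exact Eventually.of_forall fun v => tendsto_saddleIntegrand hlim v

theorem coeff_eulerProd_eq_integral {c : ℕ → ℕ} {B : ℕ} (hc0 : c 0 = 0) (hB : ∀ j, c j ≤ B)
    {A s : ℝ} (hs : 0 < s) {n : ℕ} (hn : (n : ℝ) = A / s ^ 8) :
    PowerSeries.coeff n (eulerProd c (PowerSeries.X : ℝ⟦X⟧)) =
      s ^ 6 * Real.exp (2 * A / s ^ 4) / (2 * Real.pi) * (∫ v, saddleIntegrand c A s v).re := by
  have h1 := integral_eulerProd_mul_exp hc0 hB n (by positivity : 0 < s ^ 4)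
  have hs6 : s ^ 6 ≠ 0 := by positivity
  have h2 := intervalIntegral.integral_comp_mul_left (a := -(Real.pi / s ^ 6))
    (b := Real.pi / s ^ 6) (fun θ : ℝ =>
      eulerProd c (Complex.exp (-((s ^ 4 : ℝ) + θ * Complex.I))) *
        Complex.exp (n * ((s ^ 4 : ℝ) + θ * Complex.I))) hs6
  rw [mul_neg, mul_div_cancel₀ _ hs6, h1] at h2
  have h3 : ∫ v, saddleIntegrand c A s v = Complex.exp (-(2 * A / s ^ 4 : ℝ)) *
      ∫ v in (-(Real.pi / s ^ 6))..(Real.pi / s ^ 6),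
        eulerProd c (Complex.exp (-((s ^ 4 : ℝ) + (s ^ 6 * v : ℝ) * Complex.I))) *
        Complex.exp (n * ((s ^ 4 : ℝ) + (s ^ 6 * v : ℝ) * Complex.I)) := by
    unfold saddleIntegrand
    rw [MeasureTheory.integral_indicator measurableSet_Ioc, ← intervalIntegral.integral_of_le
      (by have : 0 < Real.pi / s ^ 6 := by positivity
          linarith), ← intervalIntegral.integral_const_mul]
    congr 1
    ext v
    rw [← hn, sub_eq_add_neg, Complex.exp_add, Complex.ofReal_natCast]
    ring
  rw [h3, h2, ← Complex.ofReal_neg, ← Complex.ofReal_exp, Complex.real_smul,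
    ← Complex.ofReal_mul, ← Complex.ofReal_mul, Complex.ofReal_re, Real.exp_neg]
  have := Real.exp_pos (2 * A / s ^ 4)
  field_simp

/-- The circle method for products `∏ (1 + q ^ j) ^ c j`: the behaviour
`C e^{A / z}` of the product at `q = e^{-z}`, as `Re (1 / z) → ∞`, determines the
asymptotics of the coefficients, as soon as the exponents are positive on `1 + M ℕ`. -/
theorem coeff_eulerProd_isEquivalent {c : ℕ → ℕ} {B : ℕ} (hc0 : c 0 = 0)
    (hB : ∀ j, c j ≤ B) {M : ℕ} (hM : 2 ≤ M) (hcM : ∀ k, 1 ≤ c (1 + M * k)) {A C : ℝ}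
    (hA : 0 < A) (hC : 0 < C)
    (hlim : Tendsto (fun z : ℂ => eulerProd c (Complex.exp (-z)) * Complex.exp (-(A / z)))
      (comap (fun z : ℂ => (z⁻¹).re) atTop) (nhds C)) :
    (fun n : ℕ => PowerSeries.coeff n (eulerProd c (PowerSeries.X : ℝ⟦X⟧))) ~[atTop]
      fun n : ℕ => C * A ^ (1 / 4 : ℝ) / (2 * √Real.pi * (n : ℝ) ^ (3 / 4 : ℝ)) *
        Real.exp (2 * √(A * n)) := by
  have hs : Tendsto (fun n : ℕ => (A / n) ^ (1 / 8 : ℝ)) atTop (nhdsWithin 0 (Set.Ioi 0)) := by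
    refine tendsto_nhdsWithin_iff.mpr ⟨?_, ?_⟩
    · have h1 : Tendsto (fun n : ℕ => A / (n : ℝ)) atTop (nhds 0) :=
        tendsto_const_div_atTop_nhds_zero_nat A
      have h2 := h1.rpow_const (p := 1 / 8) (Or.inr (by norm_num))
      rwa [Real.zero_rpow (by norm_num)] at h2
    · filter_upwards [eventually_gt_atTop 0] with n hn
      have : (0 : ℝ) < n := by exact_mod_cast hn
      exact Set.mem_Ioi.mpr (by positivity)
  have hI : Tendsto (fun n : ℕ => (∫ v, saddleIntegrand c A ((A / n) ^ (1 / 8 : ℝ)) v).re) atTop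
      (nhds (C * √(Real.pi / A))) :=
    (Complex.continuous_re.tendsto _).comp
      ((tendsto_integral_saddleIntegrand hc0 hB hM hcM hlim).comp hs)
  have hne : C * √(Real.pi / A) ≠ 0 := by positivity
  have hmain := (IsEquivalent.refl (u := fun n : ℕ => ((A / n : ℝ) ^ (1 / 8 : ℝ)) ^ 6 *
    Real.exp (2 * A / ((A / n : ℝ) ^ (1 / 8 : ℝ)) ^ 4) / (2 * Real.pi)) (l := atTop)).mul
    ((isEquivalent_const_iff_tendsto hne).mpr hI)
  refine (hmain.congr_left ?_).congr_right ?_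
  · filter_upwards [eventually_gt_atTop 0] with n hn
    have hn0 : (0 : ℝ) < n := by exact_mod_cast hn
    refine (coeff_eulerProd_eq_integral hc0 hB (by positivity) ?_).symm
    rw [← Real.rpow_natCast, ← Real.rpow_mul (by positivity)]
    norm_num
    field_simp
  · filter_upwards [eventually_gt_atTop 0] with n hn
    have hn0 : (0 : ℝ) < n := by exact_mod_cast hn
    have h4 : ((A / n : ℝ) ^ (1 / 8 : ℝ)) ^ 4 = √(A / n) := by
      rw [← Real.rpow_natCast, ← Real.rpow_mul (by positivity), Real.sqrt_eq_rpow]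
      norm_num
    have h6 : ((A / n : ℝ) ^ (1 / 8 : ℝ)) ^ 6 =
        A ^ (1 / 4 : ℝ) * √A / (n : ℝ) ^ (3 / 4 : ℝ) := by
      rw [← Real.rpow_natCast, ← Real.rpow_mul (by positivity), Real.div_rpow hA.le hn0.le,
        Real.sqrt_eq_rpow, ← Real.rpow_add hA]
      norm_num
    have h5 : 2 * A / √(A / n) = 2 * √(A * n) := by
      rw [Real.sqrt_div hA.le, Real.sqrt_mul hA.le]
      have := Real.mul_self_sqrt hA.le
      have hsA : 0 < √A := Real.sqrt_pos.mpr hA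
      field_simp
      nlinarith
    have hpi := Real.mul_self_sqrt Real.pi_pos.le
    have hsA : 0 < √A := Real.sqrt_pos.mpr hA
    have hsp : 0 < √Real.pi := Real.sqrt_pos.mpr Real.pi_pos
    simp only [Pi.mul_apply, Function.const_apply]
    rw [h4, h5, h6, Real.sqrt_div Real.pi_pos.le,
      show 2 * Real.pi = 2 * (√Real.pi * √Real.pi) by rw [hpi]]
    field_simp

/-! ### The product `∏ (1 + q ^ k)` near `q = 1` -/

/-- The indicator function of the positive multiples of `m`. -/
def multipleInd (m j : ℕ) : ℕ := if j ≠ 0 ∧ m ∣ j then 1 else 0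

theorem eulerProd_multipleInd_one {R : Type*} [CommSemiring R] [TopologicalSpace R] (x : R) :
    eulerProd (multipleInd 1) x = ∏' n : ℕ, (1 + x ^ (n + 1)) := by
  have h := (add_left_injective 1).tprod_eq (g := fun n : ℕ => n + 1)
    (f := fun j => (1 + x ^ j) ^ multipleInd 1 j) (by
      intro j hj
      rcases j with _ | j
      · simp [multipleInd] at hj
      · exact ⟨j, rfl⟩)
  rw [eulerProd, ← h]
  exact tprod_congr fun n => by simp [multipleInd]

/-- The Euler function `∏_{n ≥ 1} (1 - q ^ n)`. -/
noncomputable def eulerFunction (q : ℂ) : ℂ := ∏' n : ℕ, (1 - q ^ (n + 1))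

theorem eulerProd_mul_eulerFunction {q : ℂ} (hq : ‖q‖ < 1) :
    eulerProd (multipleInd 1) q * eulerFunction q = eulerFunction (q ^ 2) := by
  have h1 : Multipliable fun n : ℕ => 1 + q ^ (n + 1) := by
    refine multipliable_one_add_of_summable ?_
    simpa using (summable_nat_add_iff 1).mpr (summable_geometric_of_lt_one (norm_nonneg _) hq)
  rw [eulerProd_multipleInd_one, eulerFunction, eulerFunction,
    ← h1.tprod_mul (ModularForm.multipliable_one_sub_pow hq)]
  exact tprod_congr fun n => by ring

theorem eta_eq_mul_eulerFunction (τ : ℂ) :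
    ModularForm.eta τ = Complex.exp (2 * Real.pi * Complex.I * τ / 24) *
      eulerFunction (Complex.exp (2 * Real.pi * Complex.I * τ)) := by
  simp [ModularForm.eta, eulerFunction, ModularForm.eta_q, Function.Periodic.qParam]

theorem I_mul_div_mem_upperHalfPlaneSet {z : ℂ} (hz : 0 < z.re) :
    Complex.I * z / (2 * Real.pi) ∈ UpperHalfPlane.upperHalfPlaneSet := by
  have h2 : Complex.I * z / (2 * Real.pi) = Complex.I * z / ((2 * Real.pi : ℝ) : ℂ) := by
    push_cast; rfl
  change 0 < (Complex.I * z / (2 * Real.pi)).im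
  rw [h2, Complex.div_ofReal_im]
  simp only [Complex.I_mul_im]
  positivity

/-- The modular transformation of `η` under `τ ↦ -1 / τ`, in the variable `z = -2πiτ`. -/
theorem eulerFunction_transformation {z : ℂ} (hz : 0 < z.re) :
    Complex.exp (-(4 * Real.pi ^ 2 / z) / 24) *
        eulerFunction (Complex.exp (-(4 * Real.pi ^ 2 / z))) =
      (Complex.sqrt Complex.I)⁻¹ * Complex.sqrt (Complex.I * z / (2 * Real.pi)) *
        (Complex.exp (-z / 24) * eulerFunction (Complex.exp (-z))) := by
  have hz0 : z ≠ 0 := by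
    rintro rfl
    simp at hz
  have hpi : (Real.pi : ℂ) ≠ 0 := by exact_mod_cast Real.pi_ne_zero
  have hmem := I_mul_div_mem_upperHalfPlaneSet hz
  have h := ModularForm.eta_comp_eq_csqrt_I_inv hmem
  simp only [Function.comp_apply, Pi.smul_apply, Pi.mul_apply, smul_eq_mul] at h
  rw [eta_eq_mul_eulerFunction, eta_eq_mul_eulerFunction, ← mul_assoc] at h
  have h1 : 2 * Real.pi * Complex.I * (-1 / (Complex.I * z / (2 * Real.pi))) =
      -(4 * Real.pi ^ 2 / z) := by
    field_simp
    ring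
  have h2 : 2 * Real.pi * Complex.I * (Complex.I * z / (2 * Real.pi)) = -z := by
    field_simp
    simp
  rwa [h1, h2] at h

theorem sqrt_two_mul {w : ℂ} (hw : w ≠ 0) :
    Complex.sqrt (2 * w) = (√2 : ℝ) * Complex.sqrt w := by
  have h2 : (2 * w : ℂ) = ((2 : ℝ) : ℂ) * w := by push_cast; rfl
  rw [sqrt_eq_exp (by simpa using hw), sqrt_eq_exp hw, h2,
    Complex.log_ofReal_mul two_pos hw, add_div, Complex.exp_add, Real.sqrt_eq_rpow,
    Real.rpow_def_of_pos two_pos]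
  push_cast
  ring_nf

theorem tendsto_eulerFunction_zero : Tendsto eulerFunction (nhds 0) (nhds 1) := by
  have h := (ModularForm.differentiableOn_tprod_one_sub_pow.differentiableAt
    (Metric.ball_mem_nhds (0 : ℂ) one_pos)).continuousAt.tendsto
  simp only [zero_pow (Nat.succ_ne_zero _), sub_zero, tprod_one] at h
  exact h

theorem eulerFunction_ne_zero {z : ℂ} (hz : 0 < z.re) : eulerFunction (Complex.exp (-z)) ≠ 0 := by
  have hpi : (Real.pi : ℂ) ≠ 0 := by exact_mod_cast Real.pi_ne_zero
  have hmem := I_mul_div_mem_upperHalfPlaneSet hz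
  have h := ModularForm.eta_ne_zero hmem
  rw [eta_eq_mul_eulerFunction] at h
  have h2 : 2 * Real.pi * Complex.I * (Complex.I * z / (2 * Real.pi)) = -z := by
    field_simp
    simp
  rw [h2] at h
  exact right_ne_zero_of_mul h

theorem re_pos_of_inv_re_pos {z : ℂ} (hz : 0 < (z⁻¹).re) : 0 < z.re := by
  rw [Complex.inv_re] at hz
  by_contra! h
  exact absurd hz (not_lt.mpr (div_nonpos_of_nonpos_of_nonneg h (Complex.normSq_nonneg z)))

/-- The product `∏ (1 + q ^ k)` at `q = e^{-z}`, expressed through values near `q = 0`. -/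
theorem eulerProd_mul_exp_eq {z : ℂ} (hz : 0 < z.re) :
    eulerProd (multipleInd 1) (Complex.exp (-z)) * Complex.exp (-((Real.pi ^ 2 / 12 : ℝ) / z)) =
      ((√2)⁻¹ : ℝ) * Complex.exp (z / 24) *
        (eulerFunction (Complex.exp (-(2 * Real.pi ^ 2 * z⁻¹))) /
          eulerFunction (Complex.exp (-(4 * Real.pi ^ 2 * z⁻¹)))) := by
  have hz0 : z ≠ 0 := by
    rintro rfl
    simp at hz
  have hpi : (Real.pi : ℂ) ≠ 0 := by exact_mod_cast Real.pi_ne_zero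
  have h1 := eulerProd_mul_eulerFunction (norm_exp_neg_lt_one hz)
  have hT := eulerFunction_transformation hz
  have hT2 := eulerFunction_transformation (z := 2 * z) (by simpa using hz)
  have hsq : Complex.exp (-z) ^ 2 = Complex.exp (-(2 * z)) := by
    rw [← Complex.exp_nat_mul]
    ring_nf
  have hw : Complex.I * z / (2 * Real.pi) ≠ 0 := by simp [hz0, hpi]
  rw [show Complex.I * (2 * z) / (2 * Real.pi) = 2 * (Complex.I * z / (2 * Real.pi)) by ring,
    sqrt_two_mul hw, show 4 * (Real.pi : ℂ) ^ 2 / (2 * z) = 2 * Real.pi ^ 2 * z⁻¹ by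
      field_simp; ring] at hT2
  rw [div_eq_mul_inv (4 * (Real.pi : ℂ) ^ 2)] at hT
  have hn2 : eulerFunction (Complex.exp (-(4 * Real.pi ^ 2 * z⁻¹))) ≠ 0 := by
    refine eulerFunction_ne_zero ?_
    have h3 : (4 * Real.pi ^ 2 * z⁻¹ : ℂ) = ((4 * Real.pi ^ 2 : ℝ) : ℂ) * z⁻¹ := by push_cast; rfl
    rw [h3, Complex.re_ofReal_mul, Complex.inv_re]
    have := Complex.normSq_pos.mpr hz0
    positivity
  rw [hsq] at h1
  set S := (Complex.sqrt Complex.I)⁻¹ * Complex.sqrt (Complex.I * z / (2 * Real.pi)) with hS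
  set F1 := eulerFunction (Complex.exp (-z))
  set F2 := eulerFunction (Complex.exp (-(2 * z)))
  set G1 := eulerFunction (Complex.exp (-(4 * Real.pi ^ 2 * z⁻¹)))
  set G2 := eulerFunction (Complex.exp (-(2 * Real.pi ^ 2 * z⁻¹)))
  set P := eulerProd (multipleInd 1) (Complex.exp (-z))
  have hS0 : S ≠ 0 := by
    intro h0
    rw [h0, zero_mul] at hT
    exact mul_ne_zero (Complex.exp_ne_zero _) hn2 hT
  have h2 : ((√2 : ℝ) : ℂ) ≠ 0 := by
    exact_mod_cast (Real.sqrt_pos.mpr two_pos).ne'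
  -- Dividing the transformation formula at `2 z` by the one at `z`.
  have hT2' : Complex.exp (-(2 * Real.pi ^ 2 * z⁻¹) / 24) * G2 =
      S * (√2 : ℝ) * Complex.exp (-(2 * z) / 24) * (P * F1) := by
    rw [hT2, h1, hS]
    ring
  have hF1 : F1 = S⁻¹ * Complex.exp (z / 24) *
      Complex.exp (-(4 * Real.pi ^ 2 * z⁻¹) / 24) * G1 := by
    have h3 : Complex.exp (z / 24) * Complex.exp (-z / 24) = 1 := by
      rw [← Complex.exp_add]
      simp [neg_div]
    calc F1 = S⁻¹ * S * (Complex.exp (z / 24) * Complex.exp (-z / 24)) * F1 := by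
          rw [h3, inv_mul_cancel₀ hS0]; ring
      _ = S⁻¹ * Complex.exp (z / 24) * (S * (Complex.exp (-z / 24) * F1)) := by ring
      _ = _ := by rw [← hT]; ring
  rw [hF1] at hT2'
  have hG2 : G2 = (√2 : ℝ) *
      (Complex.exp (-(z / 24)) * Complex.exp (-((Real.pi ^ 2 / 12 : ℝ) / z))) *
      P * G1 := by
    have h4 : Complex.exp (2 * Real.pi ^ 2 * z⁻¹ / 24) * Complex.exp (-(2 * z) / 24) *
        Complex.exp (z / 24) * Complex.exp (-(4 * Real.pi ^ 2 * z⁻¹) / 24) =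
        Complex.exp (-(z / 24)) * Complex.exp (-((Real.pi ^ 2 / 12 : ℝ) / z)) := by
      simp only [← Complex.exp_add]
      congr 1
      push_cast
      field_simp
      ring
    have h5 : Complex.exp (2 * Real.pi ^ 2 * z⁻¹ / 24) *
        Complex.exp (-(2 * Real.pi ^ 2 * z⁻¹) / 24) = 1 := by
      rw [← Complex.exp_add, neg_div, add_neg_cancel, Complex.exp_zero]
    calc G2 = Complex.exp (2 * Real.pi ^ 2 * z⁻¹ / 24) *
          (Complex.exp (-(2 * Real.pi ^ 2 * z⁻¹) / 24) * G2) := by rw [← mul_assoc, h5, one_mul]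
      _ = S * S⁻¹ * (√2 : ℝ) * (Complex.exp (2 * Real.pi ^ 2 * z⁻¹ / 24) *
          Complex.exp (-(2 * z) / 24) * Complex.exp (z / 24) *
            Complex.exp (-(4 * Real.pi ^ 2 * z⁻¹) / 24)) * P * G1 := by rw [hT2']; ring
      _ = _ := by rw [h4, mul_inv_cancel₀ hS0]; ring
  have h6 : Complex.exp (z / 24) * Complex.exp (-(z / 24)) = 1 := by
    rw [← Complex.exp_add, add_neg_cancel, Complex.exp_zero]
  rw [hG2, mul_div_assoc, div_self hn2, mul_one, Complex.ofReal_inv]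
  calc P * Complex.exp (-((Real.pi ^ 2 / 12 : ℝ) / z))
      = ((√2 : ℝ) : ℂ)⁻¹ * (√2 : ℝ) * (Complex.exp (z / 24) * Complex.exp (-(z / 24))) *
          Complex.exp (-((Real.pi ^ 2 / 12 : ℝ) / z)) * P := by
        rw [h6, inv_mul_cancel₀ h2]
        ring
    _ = _ := by ring

/-- `∏ (1 + q ^ k) ∼ 2^{-1/2} e^{π² / (12 z)}` at `q = e^{-z}` as `Re (1 / z) → ∞`. -/
theorem tendsto_eulerProd_multipleInd_one :
    Tendsto (fun z : ℂ => eulerProd (multipleInd 1) (Complex.exp (-z)) *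
        Complex.exp (-((Real.pi ^ 2 / 12 : ℝ) / z)))
      (comap (fun z : ℂ => (z⁻¹).re) atTop) (nhds (((√2)⁻¹ : ℝ) : ℂ)) := by
  set l := comap (fun z : ℂ => (z⁻¹).re) atTop
  have hre : Tendsto (fun z : ℂ => (z⁻¹).re) l atTop := tendsto_comap
  have hz : Tendsto (fun z : ℂ => z) l (nhds 0) := by
    have h1 : Tendsto (fun z : ℂ => z⁻¹) l (Bornology.cobounded ℂ) := by
      rw [← tendsto_norm_atTop_iff_cobounded]
      exact tendsto_atTop_mono (fun z => Complex.re_le_norm _) hre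
    exact (tendsto_inv₀_cobounded.comp h1).congr fun z => inv_inv z
  have hq : ∀ a : ℝ, 0 < a → Tendsto (fun z : ℂ => eulerFunction (Complex.exp (-(a * z⁻¹)))) l
      (nhds 1) := by
    intro a ha
    refine tendsto_eulerFunction_zero.comp ?_
    rw [tendsto_zero_iff_norm_tendsto_zero]
    have h1 : Tendsto (fun z : ℂ => Real.exp (-(a * (z⁻¹).re))) l (nhds 0) :=
      Real.tendsto_exp_neg_atTop_nhds_zero.comp (hre.const_mul_atTop ha)
    refine h1.congr fun z => ?_
    rw [Complex.norm_exp, Complex.neg_re, Complex.re_ofReal_mul]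
  have h2 := hq (2 * Real.pi ^ 2) (by positivity)
  have h4 := hq (4 * Real.pi ^ 2) (by positivity)
  have h5 : Tendsto (fun z : ℂ => Complex.exp (z / 24)) l (nhds 1) := by
    have : Continuous fun z : ℂ => Complex.exp (z / 24) := by fun_prop
    have h0 := this.tendsto 0
    rw [zero_div, Complex.exp_zero] at h0
    exact h0.comp hz
  have h6 := (h5.const_mul (((√2)⁻¹ : ℝ) : ℂ)).mul (h2.div h4 one_ne_zero)
  rw [mul_one, div_one, mul_one] at h6
  refine h6.congr' ?_
  filter_upwards [hre.eventually_gt_atTop 0] with z hz0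
  rw [eulerProd_mul_exp_eq (re_pos_of_inv_re_pos hz0)]
  push_cast
  rfl

/-! ### Products over odd numbers and over multiples -/

/-- The indicator function of the odd numbers. -/
def oddInd (j : ℕ) : ℕ := if Odd j then 1 else 0

/-- The indicator function of the odd numbers that are not multiples of `m`. -/
def oddNotMultipleInd (m j : ℕ) : ℕ := if Odd j ∧ ¬ m ∣ j then 1 else 0

theorem multipleInd_zero (m : ℕ) : multipleInd m 0 = 0 := by simp [multipleInd]

theorem multipleInd_le (m j : ℕ) : multipleInd m j ≤ 1 := by
  unfold multipleInd
  split_ifs <;> simp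

theorem oddInd_zero : oddInd 0 = 0 := by simp [oddInd]

theorem oddInd_le (j : ℕ) : oddInd j ≤ 1 := by
  unfold oddInd
  split_ifs <;> simp

theorem oddNotMultipleInd_zero (m : ℕ) : oddNotMultipleInd m 0 = 0 := by
  simp [oddNotMultipleInd]

theorem oddNotMultipleInd_le (m j : ℕ) : oddNotMultipleInd m j ≤ 1 := by
  unfold oddNotMultipleInd
  split_ifs <;> simp

section Algebra

variable {R : Type*} [CommSemiring R] [TopologicalSpace R]

/-- Passing from `x` to `x ^ m` spreads the exponents over the multiples of `m`. -/
theorem eulerProd_pow_right {m : ℕ} (hm : 0 < m) {c d : ℕ → ℕ} (hd : ∀ k, d (m * k) = c k)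
    (hd0 : ∀ j, ¬ m ∣ j → d j = 0) (x : R) : eulerProd c (x ^ m) = eulerProd d x := by
  have hinj : Function.Injective fun k => m * k := fun a b h => Nat.eq_of_mul_eq_mul_left hm h
  have h := hinj.tprod_eq (f := fun j => (1 + x ^ j) ^ d j) (by
    intro j hj
    by_contra hcon
    refine hj ?_
    simp only
    rw [hd0 j fun ⟨k, hk⟩ => hcon ⟨k, hk.symm⟩, pow_zero])
  rw [eulerProd, eulerProd, ← h]
  exact tprod_congr fun k => by rw [hd, pow_mul]

theorem eulerProd_multipleInd {m : ℕ} (hm : 0 < m) (x : R) :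
    eulerProd (multipleInd 1) (x ^ m) = eulerProd (multipleInd m) x := by
  refine eulerProd_pow_right hm (fun k => ?_) (fun j hj => ?_) x
  · simp [multipleInd, hm.ne']
  · simp [multipleInd, hj]

variable [T2Space R] [ContinuousMul R] {x : R}

theorem EulerConvergent.eulerProd_add (hx : EulerConvergent x) {c d : ℕ → ℕ} {B D : ℕ}
    (hc0 : c 0 = 0) (hB : ∀ j, c j ≤ B) (hd0 : d 0 = 0) (hD : ∀ j, d j ≤ D) :
    eulerProd (fun j => c j + d j) x = eulerProd c x * eulerProd d x := by
  rw [eulerProd, eulerProd, eulerProd, ← (hx c B hc0 hB).tprod_mul (hx d D hd0 hD)]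
  exact tprod_congr fun j => pow_add _ _ _

theorem EulerConvergent.eulerProd_mul_left (hx : EulerConvergent x) {c : ℕ → ℕ} {B : ℕ}
    (hc0 : c 0 = 0) (hB : ∀ j, c j ≤ B) (m : ℕ) :
    eulerProd (fun j => m * c j) x = eulerProd c x ^ m := by
  rw [eulerProd, eulerProd, ← (hx c B hc0 hB).tprod_pow]
  exact tprod_congr fun j => by rw [mul_comm, pow_mul]

theorem EulerConvergent.eulerProd_oddInd_mul (hx : EulerConvergent x) :
    eulerProd oddInd x * eulerProd (multipleInd 1) (x ^ 2) = eulerProd (multipleInd 1) x := by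
  rw [eulerProd_multipleInd two_pos, ← hx.eulerProd_add oddInd_zero oddInd_le
    (multipleInd_zero 2) (multipleInd_le 2)]
  congr 1
  ext j
  rcases Nat.even_or_odd j with h | h
  · have h' : ¬ Odd j := Nat.not_odd_iff_even.mpr h
    simp [oddInd, multipleInd, h', h.two_dvd]
  · have h' : ¬ 2 ∣ j := fun h2 => Nat.not_even_iff_odd.mpr h (even_iff_two_dvd.mpr h2)
    have h0 : j ≠ 0 := by
      rintro rfl
      simp at h
    simp [oddInd, multipleInd, h, h', h0]

theorem EulerConvergent.eulerProd_oddNotMultipleInd_mul (hx : EulerConvergent x) {m : ℕ}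
    (hm : Odd m) :
    eulerProd (oddNotMultipleInd m) x * eulerProd oddInd (x ^ m) = eulerProd oddInd x := by
  rw [eulerProd_pow_right hm.pos (d := fun j => if Odd j ∧ m ∣ j then 1 else 0)
      (fun k => by simp [oddInd, Nat.odd_mul, hm]) (fun j hj => by simp [hj]),
    ← hx.eulerProd_add (B := 1) (D := 1) (oddNotMultipleInd_zero m) (oddNotMultipleInd_le m)
      (by simp) (fun j => by split_ifs <;> simp)]
  congr 1
  ext j
  by_cases h1 : Odd j <;> by_cases h2 : m ∣ j <;> simp [oddInd, oddNotMultipleInd, h1, h2]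

end Algebra

/-! ### Exponential growth near `q = 1` -/

/-- `F(e^{-z}) ∼ C e^{A / z}` as `Re (1 / z) → ∞`, that is, as `z → 0` through the
shrinking discs `Re (1 / z) > r` tangent to the imaginary axis at `0`. -/
def HasExpGrowth (F : ℂ → ℂ) (A C : ℝ) : Prop :=
  Tendsto (fun z : ℂ => F (Complex.exp (-z)) * Complex.exp (-(A / z)))
    (comap (fun z : ℂ => (z⁻¹).re) atTop) (nhds C)

namespace HasExpGrowth

variable {F G H : ℂ → ℂ} {A A' C C' : ℝ}

theorem mul (hF : HasExpGrowth F A C) (hG : HasExpGrowth G A' C') :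
    HasExpGrowth (fun q => F q * G q) (A + A') (C * C') := by
  have h := Tendsto.mul hF hG
  rw [← Complex.ofReal_mul] at h
  refine h.congr fun z => ?_
  rw [Complex.ofReal_add, add_div, neg_add, Complex.exp_add]
  ring

theorem pow (hF : HasExpGrowth F A C) (m : ℕ) :
    HasExpGrowth (fun q => F q ^ m) (m * A) (C ^ m) := by
  have h := Tendsto.pow hF m
  rw [← Complex.ofReal_pow] at h
  refine h.congr fun z => ?_
  rw [mul_pow, ← Complex.exp_nat_mul]
  push_cast
  ring_nf

theorem congr (hF : HasExpGrowth F A C) (h : ∀ q, ‖q‖ < 1 → F q = G q) : HasExpGrowth G A C := by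
  refine Tendsto.congr' ?_ hF
  filter_upwards [(tendsto_comap (f := fun z : ℂ => (z⁻¹).re) (x := atTop)).eventually_gt_atTop 0]
    with z hz
  rw [h _ (norm_exp_neg_lt_one (re_pos_of_inv_re_pos hz))]

/-- Division: if `F G = H` in the unit disc, the growth of `H` and `G` determines that of `F`. -/
theorem of_mul (hH : HasExpGrowth H A C) (hG : HasExpGrowth G A' C') (hC' : C' ≠ 0)
    (h : ∀ q, ‖q‖ < 1 → F q * G q = H q) : HasExpGrowth F (A - A') (C / C') := by
  have hC0 : (C' : ℂ) ≠ 0 := by exact_mod_cast hC'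
  have h1 := Tendsto.div (hH.congr fun q hq => (h q hq).symm) hG hC0
  rw [← Complex.ofReal_div] at h1
  refine h1.congr' ?_
  filter_upwards [Tendsto.eventually_ne hG hC0] with z hz
  have hG0 := left_ne_zero_of_mul hz
  have h2 : Complex.exp (-((A - A' : ℝ) / z)) * Complex.exp (-(A' / z)) =
      Complex.exp (-(A / z)) := by
    rw [← Complex.exp_add]
    push_cast
    ring_nf
  simp only [Pi.div_apply]
  rw [← h2]
  have := Complex.exp_ne_zero (-(A' / z))
  field_simp

theorem comp_pow (hF : HasExpGrowth F A C) {m : ℕ} (hm : 0 < m) :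
    HasExpGrowth (fun q => F (q ^ m)) (A / m) C := by
  have hm0 : (0 : ℝ) < m := by exact_mod_cast hm
  have hz : Tendsto (fun z : ℂ => (m : ℂ) * z) (comap (fun z : ℂ => (z⁻¹).re) atTop)
      (comap (fun z : ℂ => (z⁻¹).re) atTop) := by
    rw [tendsto_comap_iff]
    refine ((tendsto_comap (f := fun z : ℂ => (z⁻¹).re)).const_mul_atTop
      (inv_pos.mpr hm0)).congr fun z => ?_
    rw [Function.comp_apply, mul_inv, ← Complex.re_ofReal_mul]
    push_cast
    rfl
  refine (Tendsto.comp hF hz).congr fun z => ?_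
  have h1 : Complex.exp (-(m * z)) = Complex.exp (-z) ^ m := by
    rw [← Complex.exp_nat_mul]
    ring_nf
  have h2 : (A : ℂ) / (m * z) = ((A / m : ℝ) : ℂ) / z := by
    push_cast
    rw [div_div]
  rw [Function.comp_apply, h1, h2]

end HasExpGrowth

theorem hasExpGrowth_multipleInd_one :
    HasExpGrowth (eulerProd (multipleInd 1)) (Real.pi ^ 2 / 12) (√2)⁻¹ :=
  tendsto_eulerProd_multipleInd_one

theorem hasExpGrowth_oddInd : HasExpGrowth (eulerProd oddInd) (Real.pi ^ 2 / 24) 1 := by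
  have h0 : (√2)⁻¹ ≠ 0 := by positivity
  have h := hasExpGrowth_multipleInd_one.of_mul (hasExpGrowth_multipleInd_one.comp_pow two_pos) h0
    fun q hq => (eulerConvergent_of_norm_lt_one hq).eulerProd_oddInd_mul
  rw [div_self h0] at h
  convert h using 1
  push_cast
  ring

/-! ### Euler's identity and the two formal products -/

theorem continuous_rescale (a : ℝ) :
    Continuous (PowerSeries.rescale a : ℝ⟦X⟧ →+* ℝ⟦X⟧) := by
  refine continuous_iff_continuousAt.mpr fun f => ?_
  refine (PowerSeries.WithPiTopology.tendsto_iff_coeff_tendsto ℝ _ _ _).mpr fun n => ?_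
  simp_rw [PowerSeries.coeff_rescale]
  exact ((PowerSeries.WithPiTopology.continuous_coeff ℝ n).tendsto f).const_mul _

theorem coeff_eulerProd_neg_X {c : ℕ → ℕ} {B : ℕ} (hc0 : c 0 = 0) (hB : ∀ j, c j ≤ B) (n : ℕ) :
    PowerSeries.coeff n (eulerProd c (-PowerSeries.X : ℝ⟦X⟧)) =
      (-1) ^ n * PowerSeries.coeff n (eulerProd c (PowerSeries.X : ℝ⟦X⟧)) := by
  have h := (eulerConvergent_of_constantCoeff_eq_zero (PowerSeries.constantCoeff_X)
    c B hc0 hB).map_tprod (PowerSeries.rescale (-1 : ℝ)) (continuous_rescale (-1))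
  rw [← PowerSeries.coeff_rescale, eulerProd, eulerProd, h]
  congr 1
  refine tprod_congr fun j => ?_
  simp [PowerSeries.rescale_X]

/-- A family of power series converging to `1` in the `X`-adic topology is multipliable. -/
theorem multipliable_of_X_pow_dvd {f : ℕ → ℝ⟦X⟧}
    (h : ∀ k, (PowerSeries.X : ℝ⟦X⟧) ^ (k + 1) ∣ f k - 1) : Multipliable f := by
  have h1 : Multipliable fun k => 1 + (f k - 1) := by
    refine PowerSeries.WithPiTopology.multipliable_one_add_of_tendsto_order_atTop_nhds_top ℝ ?_
    refine ENat.tendsto_nhds_top_iff_natCast_lt.mpr fun n =>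
      Filter.eventually_atTop.mpr ⟨n, fun k hk => ?_⟩
    have h2 : ((k + 1 : ℕ) : ℕ∞) ≤ (f k - 1).order :=
      PowerSeries.le_order _ _ fun i hi =>
        PowerSeries.X_pow_dvd_iff.mp (h k) i (by exact_mod_cast hi)
    exact lt_of_lt_of_le (by exact_mod_cast Nat.lt_succ_of_le hk) h2
  simpa using h1

/-- Euler's identity `∏ (1 + x ^ k) * ∏ (1 - x ^ (2 k - 1)) = 1`: the generating
functions of partitions into distinct parts and into odd parts agree. -/
theorem eulerProd_mul_eulerProd_oddInd_neg {x : ℝ⟦X⟧} (hx : PowerSeries.constantCoeff x = 0) :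
    eulerProd (multipleInd 1) x * eulerProd oddInd (-x) = 1 := by
  -- Splitting `E = ∏ (1 - x ^ k)` by the parity of `k` gives `E = ∏ (1 - x ^ (2 k - 1)) * (U * E)`
  -- with `U = ∏ (1 + x ^ k)`, and `E` cancels.
  have hX : (PowerSeries.X : ℝ⟦X⟧) ∣ x := PowerSeries.X_dvd_iff.mpr hx
  have hU : Multipliable fun k : ℕ => 1 + x ^ (k + 1) :=
    multipliable_of_X_pow_dvd fun k => by
      simpa using pow_dvd_pow_of_dvd hX (k + 1)
  have hE : Multipliable fun k : ℕ => 1 - x ^ (k + 1) :=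
    multipliable_of_X_pow_dvd fun k => by
      simpa using pow_dvd_pow_of_dvd hX (k + 1)
  have hE0 : ∏' k : ℕ, (1 - x ^ (k + 1)) ≠ 0 := by
    intro h
    have h1 := hE.map_tprod (PowerSeries.constantCoeff (R := ℝ))
      (PowerSeries.WithPiTopology.continuous_constantCoeff ℝ)
    rw [h] at h1
    simp [hx] at h1
  have hinj : Function.Injective fun k : ℕ => 2 * k + 1 := fun a b h => by
    have : 2 * a + 1 = 2 * b + 1 := h
    omega
  have hsupp : ∀ j ∉ Set.range (fun k : ℕ => 2 * k + 1), (1 + (-x) ^ j) ^ oddInd j = 1 := by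
    intro j hj
    have : ¬ Odd j := fun ⟨k, hk⟩ => hj ⟨k, hk.symm⟩
    simp [oddInd, this]
  have hfac : ∀ k : ℕ, (1 + (-x) ^ (2 * k + 1)) ^ oddInd (2 * k + 1) = 1 - x ^ (2 * k + 1) := by
    intro k
    have h1 : Odd (2 * k + 1) := odd_two_mul_add_one k
    simp [oddInd, h1, h1.neg_pow, sub_eq_add_neg]
  have hOm : Multipliable fun k : ℕ => 1 - x ^ (2 * k + 1) := by
    have h1 := (hinj.multipliable_iff hsupp).mpr
      (eulerConvergent_of_constantCoeff_eq_zero (by simpa using hx) oddInd 1 oddInd_zero oddInd_le)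
    exact h1.congr hfac
  have hO : eulerProd oddInd (-x) = ∏' k : ℕ, (1 - x ^ (2 * k + 1)) := by
    rw [eulerProd, ← hinj.tprod_eq (f := fun j => (1 + (-x) ^ j) ^ oddInd j) (by
      intro j hj
      by_contra hcon
      exact hj (hsupp j hcon))]
    exact tprod_congr hfac
  have hUE : ∀ k : ℕ, (1 + x ^ (k + 1)) * (1 - x ^ (k + 1)) = 1 - x ^ (2 * k + 1 + 1) :=
    fun k => by ring
  have heven : Multipliable fun k : ℕ => 1 - x ^ (2 * k + 1 + 1) := (hU.mul hE).congr hUE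
  have h := tprod_even_mul_odd (f := fun n : ℕ => 1 - x ^ (n + 1)) hOm heven
  have h2 : ∏' k : ℕ, (1 - x ^ (2 * k + 1 + 1)) =
      eulerProd (multipleInd 1) x * ∏' k : ℕ, (1 - x ^ (k + 1)) := by
    rw [eulerProd_multipleInd_one, ← hU.tprod_mul hE]
    exact tprod_congr fun k => (hUE k).symm
  rw [h2, ← hO] at h
  refine mul_right_cancel₀ hE0 ?_
  linear_combination h

theorem multipliable_one_add_X_pow :
    Multipliable fun k : ℕ => 1 + (PowerSeries.X : ℝ⟦X⟧) ^ (k + 1) :=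
  multipliable_of_X_pow_dvd fun k => by simp

theorem one_add_X_pow_mul_inv (k : ℕ) :
    (1 + (PowerSeries.X : ℝ⟦X⟧) ^ (k + 1)) * (1 + (PowerSeries.X : ℝ⟦X⟧) ^ (k + 1))⁻¹ = 1 :=
  PowerSeries.mul_inv_cancel _ (by simp)

theorem pow_mul_invPowFactor (m k : ℕ) :
    (1 + (PowerSeries.X : ℝ⟦X⟧) ^ (k + 1)) ^ m * invPowFactor m (k + 1) = 1 :=
  PowerSeries.mul_inv_cancel _ (by simp)

theorem multipliable_invPowFactor (m : ℕ) : Multipliable fun k => invPowFactor m (k + 1) := by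
  refine multipliable_of_X_pow_dvd fun k => ?_
  have h1 : (PowerSeries.X : ℝ⟦X⟧) ^ (k + 1) ∣ (1 + PowerSeries.X ^ (k + 1)) ^ m - 1 := by
    simpa using sub_dvd_pow_sub_pow (1 + (PowerSeries.X : ℝ⟦X⟧) ^ (k + 1)) 1 m
  have h2 : invPowFactor m (k + 1) - 1 =
      ((1 + (PowerSeries.X : ℝ⟦X⟧) ^ (k + 1)) ^ m - 1) * -invPowFactor m (k + 1) := by
    linear_combination pow_mul_invPowFactor m k
  rw [h2]
  exact h1.mul_right _

theorem multipliable_ratioFactor {m : ℕ} (hm : 0 < m) :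
    Multipliable fun k => ratioFactor m (k + 1) := by
  refine multipliable_of_X_pow_dvd fun k => ?_
  have h1 : (PowerSeries.X : ℝ⟦X⟧) ^ (k + 1) ∣
      PowerSeries.X ^ (m * (k + 1)) - PowerSeries.X ^ (k + 1) :=
    dvd_sub (pow_dvd_pow _ (Nat.le_mul_of_pos_left _ hm)) dvd_rfl
  have h2 : ratioFactor m (k + 1) - 1 =
      ((PowerSeries.X : ℝ⟦X⟧) ^ (m * (k + 1)) - PowerSeries.X ^ (k + 1)) *
        (1 + (PowerSeries.X : ℝ⟦X⟧) ^ (k + 1))⁻¹ := by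
    rw [ratioFactor]
    linear_combination one_add_X_pow_mul_inv k
  rw [h2]
  exact h1.mul_right _

theorem invPowProduct_eq (m : ℕ) :
    invPowProduct m = eulerProd (fun j => m * oddInd j) (-PowerSeries.X) := by
  have hneg : EulerConvergent (-PowerSeries.X : ℝ⟦X⟧) :=
    eulerConvergent_of_constantCoeff_eq_zero (by simp)
  have h1 : eulerProd (multipleInd 1) (PowerSeries.X : ℝ⟦X⟧) ^ m * invPowProduct m = 1 := by
    rw [eulerProd_multipleInd_one, invPowProduct, ← multipliable_one_add_X_pow.tprod_pow,
      ← (multipliable_one_add_X_pow.pow m).tprod_mul (multipliable_invPowFactor m)]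
    simp_rw [pow_mul_invPowFactor, tprod_one]
  have h2 := congrArg (· ^ m) (eulerProd_mul_eulerProd_oddInd_neg (x := PowerSeries.X)
    PowerSeries.constantCoeff_X)
  simp only [mul_pow, one_pow] at h2
  rw [hneg.eulerProd_mul_left oddInd_zero oddInd_le]
  linear_combination (eulerProd oddInd (-PowerSeries.X) ^ m) * h1 - invPowProduct m * h2

theorem ratioProduct_eq {m : ℕ} (hm : 0 < m) :
    ratioProduct m = eulerProd (multipleInd 1) (PowerSeries.X ^ m : ℝ⟦X⟧) *
      eulerProd oddInd (-PowerSeries.X) := by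
  have h1 : eulerProd (multipleInd 1) (PowerSeries.X : ℝ⟦X⟧) * ratioProduct m =
      eulerProd (multipleInd 1) (PowerSeries.X ^ m : ℝ⟦X⟧) := by
    rw [eulerProd_multipleInd_one, eulerProd_multipleInd_one, ratioProduct,
      ← multipliable_one_add_X_pow.tprod_mul (multipliable_ratioFactor hm)]
    refine tprod_congr fun k => ?_
    rw [ratioFactor, mul_left_comm, one_add_X_pow_mul_inv, mul_one, pow_mul]
  have h2 := eulerProd_mul_eulerProd_oddInd_neg (x := PowerSeries.X) PowerSeries.constantCoeff_X
  linear_combination (eulerProd oddInd (-PowerSeries.X : ℝ⟦X⟧)) * h1 - ratioProduct m * h2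

theorem ratioProduct_eq_of_even {m : ℕ} (hm : 0 < m) (hev : Even m) :
    ratioProduct m = eulerProd (fun j => multipleInd m j + oddInd j) (-PowerSeries.X) := by
  have hneg : EulerConvergent (-PowerSeries.X : ℝ⟦X⟧) :=
    eulerConvergent_of_constantCoeff_eq_zero (by simp)
  rw [ratioProduct_eq hm, hneg.eulerProd_add (multipleInd_zero m) (multipleInd_le m) oddInd_zero
    oddInd_le, ← eulerProd_multipleInd hm, hev.neg_pow]

theorem ratioProduct_eq_of_odd {m : ℕ} (hodd : Odd m) :
    ratioProduct m = eulerProd (oddNotMultipleInd m) (-PowerSeries.X) := by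
  have hneg : EulerConvergent (-PowerSeries.X : ℝ⟦X⟧) :=
    eulerConvergent_of_constantCoeff_eq_zero (by simp)
  have h1 := hneg.eulerProd_oddNotMultipleInd_mul hodd
  have h2 := eulerProd_mul_eulerProd_oddInd_neg (x := (PowerSeries.X : ℝ⟦X⟧) ^ m)
    (by simp [hodd.pos.ne'])
  rw [hodd.neg_pow] at h1
  rw [ratioProduct_eq hodd.pos, ← h1]
  linear_combination (eulerProd (oddNotMultipleInd m) (-PowerSeries.X)) * h2

/-- `coeff_eulerProd_isEquivalent` at `-q`, with `A = π² a`. -/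
theorem coeff_eulerProd_neg_X_isEquivalent {c : ℕ → ℕ} {B : ℕ} (hc0 : c 0 = 0)
    (hB : ∀ j, c j ≤ B) {M : ℕ} (hM : 2 ≤ M) (hcM : ∀ k, 1 ≤ c (1 + M * k)) {a C : ℝ}
    (ha : 0 < a) (hC : 0 < C) (h : HasExpGrowth (eulerProd c) (Real.pi ^ 2 * a) C) :
    (fun n : ℕ => PowerSeries.coeff n (eulerProd c (-PowerSeries.X : ℝ⟦X⟧))) ~[atTop]
      fun n : ℕ => (-1 : ℝ) ^ n * (C * a ^ (1 / 4 : ℝ) / (2 * (n : ℝ) ^ (3 / 4 : ℝ))) *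
        Real.exp (Real.pi * √(4 * a * n)) := by
  have h1 := (IsEquivalent.refl (u := fun n : ℕ => (-1 : ℝ) ^ n) (l := atTop)).mul
    (coeff_eulerProd_isEquivalent hc0 hB hM hcM (by positivity) hC h)
  refine (h1.congr_left ?_).congr_right ?_
  · exact Eventually.of_forall fun n => (coeff_eulerProd_neg_X hc0 hB n).symm
  · refine Eventually.of_forall fun n => ?_
    have h2 : (Real.pi ^ 2 * a) ^ (1 / 4 : ℝ) = √Real.pi * a ^ (1 / 4 : ℝ) := by
      rw [Real.mul_rpow (by positivity) ha.le, ← Real.rpow_natCast, ← Real.rpow_mul Real.pi_pos.le,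
        Real.sqrt_eq_rpow]
      norm_num
    have h3 : 2 * √(Real.pi ^ 2 * a * n) = Real.pi * √(4 * a * n) := by
      rw [show 4 * a * n = 2 ^ 2 * (a * n) by ring, mul_assoc,
        Real.sqrt_mul (sq_nonneg Real.pi), Real.sqrt_mul (sq_nonneg 2),
        Real.sqrt_sq Real.pi_pos.le, Real.sqrt_sq two_pos.le]
      ring
    have hsp : 0 < √Real.pi := Real.sqrt_pos.mpr Real.pi_pos
    simp only [Pi.mul_apply]
    rw [h2, h3, ← mul_assoc, show C * (√Real.pi * a ^ (1 / 4 : ℝ)) /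
        (2 * √Real.pi * (n : ℝ) ^ (3 / 4 : ℝ)) =
        √Real.pi * (C * a ^ (1 / 4 : ℝ)) / (√Real.pi * (2 * (n : ℝ) ^ (3 / 4 : ℝ))) by ring,
      mul_div_mul_left _ _ hsp.ne']

/-! ### Asymptotics of the coefficients -/

theorem four_rpow_quarter : (4 : ℝ) ^ (1 / 4 : ℝ) = √2 := by
  rw [show (4 : ℝ) = 2 ^ (2 : ℝ) by norm_num, ← Real.rpow_mul two_pos.le, Real.sqrt_eq_rpow]
  norm_num

theorem coeff_invPowProduct_isEquivalent {m : ℕ} (hm : 0 < m) :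
    (fun n : ℕ => PowerSeries.coeff n (invPowProduct m)) ~[atTop]
      (fun n : ℕ => (-1 : ℝ) ^ n *
        ((m : ℝ) ^ (1 / 4 : ℝ) /
          ((2 : ℝ) ^ (7 / 4 : ℝ) * (3 : ℝ) ^ (1 / 4 : ℝ) * (n : ℝ) ^ (3 / 4 : ℝ))) *
        Real.exp (Real.pi * √((m : ℝ) * (n : ℝ) / 6))) := by
  have hm0 : (0 : ℝ) < m := by exact_mod_cast hm
  have hgrowth : HasExpGrowth (eulerProd fun j => m * oddInd j) (Real.pi ^ 2 * (m / 24)) 1 := by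
    have h := (hasExpGrowth_oddInd.pow m).congr fun q hq =>
      ((eulerConvergent_of_norm_lt_one hq).eulerProd_mul_left oddInd_zero oddInd_le m).symm
    rw [one_pow] at h
    convert h using 1
    ring
  have h := coeff_eulerProd_neg_X_isEquivalent (c := fun j => m * oddInd j) (B := m)
    (by simp [oddInd]) (fun j => by simpa using Nat.mul_le_mul_left m (oddInd_le j)) le_rfl
    (fun k => by
      have : Odd (1 + 2 * k) := by simp
      simpa [oddInd, this, Nat.one_le_iff_ne_zero] using hm.ne') (by positivity) one_pos hgrowth
  simp_rw [invPowProduct_eq]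
  refine h.congr_right (Eventually.of_forall fun n => ?_)
  have h1 : 4 * ((m : ℝ) / 24) * n = m * n / 6 := by ring
  have h2 : (2 : ℝ) ^ (7 / 4 : ℝ) = 2 * 2 ^ (3 / 4 : ℝ) := by
    rw [← Real.rpow_one_add' two_pos.le (by norm_num)]
    norm_num
  have h3 : (24 : ℝ) ^ (1 / 4 : ℝ) = 2 ^ (3 / 4 : ℝ) * 3 ^ (1 / 4 : ℝ) := by
    rw [show (24 : ℝ) = 2 ^ (3 : ℝ) * 3 by norm_num, Real.mul_rpow (by positivity) (by positivity),
      ← Real.rpow_mul two_pos.le]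
    norm_num
  simp only
  rw [h1, h2, Real.div_rpow hm0.le (by norm_num), h3, one_mul, div_div]
  ring_nf

theorem coeff_ratioProduct_isEquivalent_of_even {m : ℕ} (hm : 0 < m) (hev : Even m) :
    (fun n : ℕ => PowerSeries.coeff n (ratioProduct m)) ~[atTop]
      (fun n : ℕ => (-1 : ℝ) ^ n *
        (((m : ℝ) + 2) ^ (1 / 4 : ℝ) /
          (4 * (6 * (m : ℝ)) ^ (1 / 4 : ℝ) * (n : ℝ) ^ (3 / 4 : ℝ))) *
        Real.exp (Real.pi * √(((m : ℝ) + 2) * (n : ℝ) / (6 * (m : ℝ))))) := by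
  have hm0 : (0 : ℝ) < m := by exact_mod_cast hm
  have hgrowth : HasExpGrowth (eulerProd fun j => multipleInd m j + oddInd j)
      (Real.pi ^ 2 * ((m + 2) / (24 * m))) (√2)⁻¹ := by
    have h := ((hasExpGrowth_multipleInd_one.comp_pow hm).mul hasExpGrowth_oddInd).congr
      (G := eulerProd fun j => multipleInd m j + oddInd j) fun q hq => by
        rw [eulerProd_multipleInd hm]
        exact ((eulerConvergent_of_norm_lt_one hq).eulerProd_add (multipleInd_zero m)
          (multipleInd_le m) oddInd_zero oddInd_le).symm
    rw [mul_one] at h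
    convert h using 1
    field_simp
    ring
  have h := coeff_eulerProd_neg_X_isEquivalent (c := fun j => multipleInd m j + oddInd j) (B := 2)
    (by simp [oddInd, multipleInd]) (fun j => add_le_add (multipleInd_le m j) (oddInd_le j)) le_rfl
    (fun k => by
      have : Odd (1 + 2 * k) := by simp
      simp [oddInd, this]) (by positivity) (by positivity) hgrowth
  rw [ratioProduct_eq_of_even hm hev]
  refine h.congr_right (Eventually.of_forall fun n => ?_)
  have h1 : 4 * (((m : ℝ) + 2) / (24 * m)) * n = (m + 2) * n / (6 * m) := by
    field_simp
    ring
  have h2 : (24 * (m : ℝ)) ^ (1 / 4 : ℝ) = √2 * (6 * m) ^ (1 / 4 : ℝ) := by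
    rw [show 24 * (m : ℝ) = 4 * (6 * m) by ring, Real.mul_rpow (by norm_num) (by positivity),
      four_rpow_quarter]
  have h3 : 4 = √2 * √2 * 2 := by rw [Real.mul_self_sqrt two_pos.le]; norm_num
  simp only
  rw [h1, Real.div_rpow (by positivity) (by positivity), h2, h3]
  field_simp

theorem coeff_ratioProduct_isEquivalent_of_odd {m : ℕ} (hm : 1 < m) (hodd : Odd m) :
    (fun n : ℕ => PowerSeries.coeff n (ratioProduct m)) ~[atTop]
      (fun n : ℕ => (-1 : ℝ) ^ n *
        (((m : ℝ) - 1) ^ (1 / 4 : ℝ) /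
          ((2 : ℝ) ^ (3 / 2 : ℝ) * (6 * (m : ℝ)) ^ (1 / 4 : ℝ) * (n : ℝ) ^ (3 / 4 : ℝ))) *
        Real.exp (Real.pi * √(((m : ℝ) - 1) * (n : ℝ) / (6 * (m : ℝ))))) := by
  have hm1 : (1 : ℝ) < m := by exact_mod_cast hm
  have hm0 : (0 : ℝ) < m := by linarith
  have hm2 : (0 : ℝ) < m - 1 := by linarith
  have hgrowth : HasExpGrowth (eulerProd (oddNotMultipleInd m))
      (Real.pi ^ 2 * ((m - 1) / (24 * m))) 1 := by
    have h := hasExpGrowth_oddInd.of_mul (hasExpGrowth_oddInd.comp_pow hodd.pos) one_ne_zero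
      fun q hq => (eulerConvergent_of_norm_lt_one hq).eulerProd_oddNotMultipleInd_mul hodd
    rw [div_one] at h
    convert h using 1
    field_simp
  have h := coeff_eulerProd_neg_X_isEquivalent (M := 2 * m) (oddNotMultipleInd_zero m)
    (oddNotMultipleInd_le m) (by omega) (fun k => by
      have h1 : Odd (1 + 2 * m * k) := by simp [mul_assoc]
      have h2 : ¬ m ∣ 1 + 2 * m * k := by
        rw [Nat.dvd_add_left ⟨2 * k, by ring⟩, Nat.dvd_one]
        omega
      simp [oddNotMultipleInd, h1, h2]) (by positivity) one_pos hgrowth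
  rw [ratioProduct_eq_of_odd hodd]
  refine h.congr_right (Eventually.of_forall fun n => ?_)
  have h1 : 4 * (((m : ℝ) - 1) / (24 * m)) * n = (m - 1) * n / (6 * m) := by
    field_simp
    ring
  have h2 : (24 * (m : ℝ)) ^ (1 / 4 : ℝ) = √2 * (6 * m) ^ (1 / 4 : ℝ) := by
    rw [show 24 * (m : ℝ) = 4 * (6 * m) by ring, Real.mul_rpow (by norm_num) (by positivity),
      four_rpow_quarter]
  have h3 : (2 : ℝ) ^ (3 / 2 : ℝ) = 2 * √2 := by
    rw [Real.sqrt_eq_rpow, ← Real.rpow_one_add' two_pos.le (by norm_num)]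
    norm_num
  simp only
  rw [h1, Real.div_rpow hm2.le (by positivity), h2, h3, one_mul, div_div]
  ring_nf

theorem mainTheorem8 :
    (∀ m : ℕ, 0 < m →
      Multipliable (fun k : ℕ => invPowFactor m (k + 1)) ∧
      (fun n : ℕ => PowerSeries.coeff n (invPowProduct m)) ~[atTop]
        (fun n : ℕ => (-1 : ℝ) ^ n *
          ((m : ℝ) ^ (1 / 4 : ℝ) /
            ((2 : ℝ) ^ (7 / 4 : ℝ) * (3 : ℝ) ^ (1 / 4 : ℝ) * (n : ℝ) ^ (3 / 4 : ℝ))) *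
          Real.exp (Real.pi * √((m : ℝ) * (n : ℝ) / 6)))) ∧
    (∀ m : ℕ, 1 < m →
      Multipliable (fun k : ℕ => ratioFactor m (k + 1)) ∧
      (Even m →
        (fun n : ℕ => PowerSeries.coeff n (ratioProduct m)) ~[atTop]
          (fun n : ℕ => (-1 : ℝ) ^ n *
            (((m : ℝ) + 2) ^ (1 / 4 : ℝ) /
              (4 * (6 * (m : ℝ)) ^ (1 / 4 : ℝ) * (n : ℝ) ^ (3 / 4 : ℝ))) *
            Real.exp (Real.pi * √(((m : ℝ) + 2) * (n : ℝ) / (6 * (m : ℝ)))))) ∧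
      (Odd m →
        (fun n : ℕ => PowerSeries.coeff n (ratioProduct m)) ~[atTop]
          (fun n : ℕ => (-1 : ℝ) ^ n *
            (((m : ℝ) - 1) ^ (1 / 4 : ℝ) /
              ((2 : ℝ) ^ (3 / 2 : ℝ) * (6 * (m : ℝ)) ^ (1 / 4 : ℝ) * (n : ℝ) ^ (3 / 4 : ℝ))) *
            Real.exp (Real.pi * √(((m : ℝ) - 1) * (n : ℝ) / (6 * (m : ℝ))))))) :=
  ⟨fun m hm => ⟨multipliable_invPowFactor m, coeff_invPowProduct_isEquivalent hm⟩,
    fun _ hm => ⟨multipliable_ratioFactor (by omega),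
      coeff_ratioProduct_isEquivalent_of_even (by omega),
      coeff_ratioProduct_isEquivalent_of_odd hm⟩⟩
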